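/- **Lemma.** Let $(M,I,\langle\cdot,\cdot\rangle)$ be an almost Hermitian manifold of dimension $2n$, $n\ge 2$: a smooth manifold with a smooth Riemannian metric and a smooth almost complex structure $I$ that is orthogonal for the metric. Let $\nabla$ be the Levi-Civita connection and let $\widetilde\nabla=\nabla+\xi$ be the minimal $U(n)$-connection, i.e. the unique metric connection with $\widetilde\nabla I=0$ such that each $\xi_X=\widetilde\nabla_X-\nabla_X$ is orthogonal to $\mathfrak u(n)$ in $\mathfrak{so}(2n)$, where $\mathfrak u(n)$ consists of the skew-symmetric endomorphisms commuting with $I$. Put $(I\xi)_XY=I(\xi_XY)$, $R_{X,Y}=\nabla_{[X,Y]}-[\nabla_X,\nabla_Y]$ and $$\mathrm{Ric}(X,Y)=\langle R_{X,e_i}Y,e_i\rangle,\qquad \mathrm{Ric}^*(X,Y)=\langle R_{X,e_i}IY,Ie_i\rangle ,$$ where $e_1,\dots,e_{2n}$ is an orthonormal basis of the tangent space and, here and below, one sums over the repeated index $i$. For a bilinear form $b$ on a tangent space put $$b_H(X,Y)=\tfrac12\big(b(X,Y)+b(IX,IY)\big),\qquad b_{AH}(X,Y)=\tfrac12\big(b(X,Y)-b(IX,IY)\big).$$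 Then for all tangent vectors $X,Y$ at a point and every orthonormal basis $(e_i)$ of the tangent space at that point: (1) $$\begin{aligned} \mathrm{Ric}^*(X,Y)-\mathrm{Ric}(X,Y) &=2\langle(\nabla_{e_i}I\xi)_XIY,e_i\rangle-2\langle(\nabla_XI\xi)_{e_i}IY,e_i\rangle\\ &=2\langle(\widetilde\nabla_{e_i}\xi)_XY,e_i\rangle-2\langle(\widetilde\nabla_X\xi)_{e_i}Y,e_i\rangle +2\langle\xi_{\xi_{e_i}X}Y,e_i\rangle-2\langle\xi_{\xi_Xe_i}Y,e_i\rangle . \end{aligned}$$ (2) Consequently, $$\begin{aligned} (\mathrm{Ric}^*_H-\mathrm{Ric}_H)(X,Y) ={}&\langle(\widetilde\nabla_{e_i}\xi)_XY,e_i\rangle-\langle(\widetilde\nabla_X\xi)_{e_i}Y,e_i\rangle +\langle(\widetilde\nabla_{e_i}\xi)_{IX}IY,e_i\rangle-\langle(\widetilde\nabla_{IX}\xi)_{e_i}IY,e_i\rangle\\ &+\langle\xi_{\xi_{e_i}X}Y,e_i\rangle-\langle\xi_{\xi_Xe_i}Y,e_i\rangle +\langle\xi_{\xi_{e_i}IX}IY,e_i\rangle-\langle\xi_{\xi_{IX}e_i}IY,e_i\rangle,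 \end{aligned}$$ $$\begin{aligned} 2\,\mathrm{Ric}^*_{AH}(X,Y) ={}&\langle(\widetilde\nabla_{e_i}\xi)_XY,e_i\rangle-\langle(\widetilde\nabla_{e_i}\xi)_YX,e_i\rangle -\langle(\widetilde\nabla_{e_i}\xi)_{IX}IY,e_i\rangle+\langle(\widetilde\nabla_{e_i}\xi)_{IY}IX,e_i\rangle\\ &-\langle(\widetilde\nabla_X\xi)_{e_i}Y,e_i\rangle+\langle(\widetilde\nabla_Y\xi)_{e_i}X,e_i\rangle +\langle(\widetilde\nabla_{IX}\xi)_{e_i}IY,e_i\rangle-\langle(\widetilde\nabla_{IY}\xi)_{e_i}IX,e_i\rangle\\ &-\langle\xi_{\xi_Xe_i}Y,e_i\rangle+\langle\xi_{\xi_Ye_i}X,e_i\rangle +\langle\xi_{\xi_{IX}e_i}IY,e_i\rangle-\langle\xi_{\xi_{IY}e_i}IX,e_i\rangle, \end{aligned}$$ $$\begin{aligned} 2\,\mathrm{Ric}_{AH}(X,Y) ={}&-\langle(\widetilde\nabla_{e_i}\xi)_XY,e_i\rangle+\langle(\widetilde\nabla_X\xi)_{e_i}Y,e_i\rangle -\langle(\widetilde\nabla_{e_i}\xi)_YX,e_i\rangle+\langle(\widetilde\nabla_Y\xi)_{e_i}X,e_i\rangle\\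 &+\langle(\widetilde\nabla_{e_i}\xi)_{IX}IY,e_i\rangle-\langle(\widetilde\nabla_{IX}\xi)_{e_i}IY,e_i\rangle +\langle(\widetilde\nabla_{e_i}\xi)_{IY}IX,e_i\rangle-\langle(\widetilde\nabla_{IY}\xi)_{e_i}IX,e_i\rangle\\ &-\langle\xi_{\xi_{e_i}X}Y,e_i\rangle+\langle\xi_{\xi_Xe_i}Y,e_i\rangle -\langle\xi_{\xi_{e_i}Y}X,e_i\rangle+\langle\xi_{\xi_Ye_i}X,e_i\rangle\\ &+\langle\xi_{\xi_{e_i}IX}IY,e_i\rangle-\langle\xi_{\xi_{IX}e_i}IY,e_i\rangle +\langle\xi_{\xi_{e_i}IY}IX,e_i\rangle-\langle\xi_{\xi_{IY}e_i}IX,e_i\rangle . \end{aligned}$$ -/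

import Mathlib

open Bundle FiberBundle NormedSpace VectorField
open scoped Manifold ContDiff

set_option linter.unusedSectionVars false

noncomputable section

namespace AlmostHermitian

variable {E : Type*} [NormedAddCommGroup E] [NormedSpace ℝ E] [FiniteDimensional ℝ E]
  {H : Type*} [TopologicalSpace H] {I : ModelWithCorners ℝ E H}
  {M : Type*} [TopologicalSpace M] [ChartedSpace H M] [IsManifold I ∞ M]
  [RiemannianBundle (fun x : M ↦ TangentSpace I x)]
  [IsContMDiffRiemannianBundle I ∞ E (fun x : M ↦ TangentSpace I x)]

/-- The right hand side of Koszul's formula for `2 ⟨∇_X Y, Z⟩`. -/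
def koszul (X Y Z : Π x : M, TangentSpace I x) (x : M) : ℝ :=
  d% (fun y ↦ inner ℝ (Y y) (Z y)) x (X x) + d% (fun y ↦ inner ℝ (X y) (Z y)) x (Y x)
    - d% (fun y ↦ inner ℝ (X y) (Y y)) x (Z x)
    + inner ℝ (mlieBracket I X Y x) (Z x) - inner ℝ (mlieBracket I X Z x) (Y x)
    - inner ℝ (mlieBracket I Y Z x) (X x)


theorem inner_mdiff {X Y : Π x : M, TangentSpace I x} {x : M}
    (hX : MDiffAt (T% X) x) (hY : MDiffAt (T% Y) x) :
    MDiffAt (fun y ↦ (inner ℝ (X y) (Y y) : ℝ)) x := 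
  MDifferentiableAt.inner_bundle (E := fun x : M ↦ TangentSpace I x) (b := fun y : M ↦ y) (IB := I) (F := E) (v := X) (w := Y) hX hY

theorem koszul_tensorial_left {Y Z : Π x : M, TangentSpace I x} {x : M}
    (hY : MDiffAt (T% Y) x) (hZ : MDiffAt (T% Z) x) :
    TensorialAt I E (fun X ↦ koszul X Y Z x) x where
  smul {f X} hf hX := by
    have : CompleteSpace E := FiniteDimensional.complete ℝ E
    have hXZ := inner_mdiff hX hZ
    have hXY := inner_mdiff hX hY
    simp [koszul, mlieBracket_smul_left hf hX, inner_add_left, inner_smul_left, inner_smul_right,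
      mvfderiv_fun_mul hf hXZ, mvfderiv_fun_mul hf hXY]
    rw [real_inner_comm (Z x) (X x)]
    ring
  add {X X'} hX hX' := by
    have : CompleteSpace E := FiniteDimensional.complete ℝ E
    have hXZ := inner_mdiff hX hZ
    have hXY := inner_mdiff hX hY
    have hXZ' := inner_mdiff hX' hZ
    have hXY' := inner_mdiff hX' hY
    simp [koszul, mlieBracket_add_left hX hX', inner_add_left, inner_add_right,
      mvfderiv_fun_add hXZ hXZ', mvfderiv_fun_add hXY hXY']
    ring

theorem koszul_tensorial_right {X Y : Π x : M, TangentSpace I x} {x : M}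
    (hX : MDiffAt (T% X) x) (hY : MDiffAt (T% Y) x) :
    TensorialAt I E (fun Z ↦ koszul X Y Z x) x where
  smul {f Z} hf hZ := by
    have : CompleteSpace E := FiniteDimensional.complete ℝ E
    have hXZ := inner_mdiff hX hZ
    have hYZ := inner_mdiff hY hZ
    simp [koszul, mlieBracket_smul_right hf hZ, inner_add_left, inner_smul_left, inner_smul_right,
      mvfderiv_fun_mul hf hXZ, mvfderiv_fun_mul hf hYZ]
    rw [real_inner_comm (Y x) (Z x), real_inner_comm (X x) (Z x)]
    ring
  add {Z Z'} hZ hZ' := by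
    have : CompleteSpace E := FiniteDimensional.complete ℝ E
    have hXZ := inner_mdiff hX hZ
    have hYZ := inner_mdiff hY hZ
    have hXZ' := inner_mdiff hX hZ'
    have hYZ' := inner_mdiff hY hZ'
    simp [koszul, mlieBracket_add_right hZ hZ', inner_add_left, inner_add_right,
      mvfderiv_fun_add hXZ hXZ', mvfderiv_fun_add hYZ hYZ']
    ring


instance (x : M) : FiniteDimensional ℝ (TangentSpace I x) :=
  inferInstanceAs (FiniteDimensional ℝ E)

instance (x : M) : CompleteSpace (TangentSpace I x) := FiniteDimensional.complete ℝ _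


/-- For a fixed vector field `Y`, differentiable at `x`, the bilinear form
`(X, Z) ↦ koszul X Y Z x` on the tangent space at `x`. -/
def koszulForm (Y : Π x : M, TangentSpace I x) (x : M) (hY : MDiffAt (T% Y) x) :
    TangentSpace I x →L[ℝ] TangentSpace I x →L[ℝ] ℝ :=
  TensorialAt.mkHom₂ (I := I) (F := E) (F' := E) (fun X Z ↦ koszul X Y Z x) x
    (fun _ hZ ↦ koszul_tensorial_left hY hZ) (fun _ hX ↦ koszul_tensorial_right hX hY)

open scoped Classical in
/-- The Levi-Civita derivative of `Y` at `x`, given by Koszul's formula: the linear map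
`v ↦ ∇_v Y` with `⟨∇_v Y, w⟩ = ½ koszulForm Y x v w`. (Junk value `0` if `Y` is not
differentiable at `x`.) -/
def leviCivitaFun (Y : Π x : M, TangentSpace I x) (x : M) :
    TangentSpace I x →L[ℝ] TangentSpace I x :=
  if hY : MDiffAt (T% Y) x then
    LinearMap.toContinuousLinearMap
      { toFun := fun v ↦
          (2⁻¹ : ℝ) • (InnerProductSpace.toDual ℝ (TangentSpace I x)).symm (koszulForm Y x hY v)
        map_add' := by intro v w; simp
        map_smul' := by intro c v; simp [smul_comm c] }
  else 0

theorem inner_leviCivitaFun {X Y Z : Π x : M, TangentSpace I x} {x : M}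
    (hX : MDiffAt (T% X) x) (hY : MDiffAt (T% Y) x) (hZ : MDiffAt (T% Z) x) :
    inner ℝ (leviCivitaFun Y x (X x)) (Z x) = 2⁻¹ * koszul X Y Z x := by
  have h := TensorialAt.mkHom₂_apply (I := I) (F := E) (F' := E) (Φ := fun X Z ↦ koszul X Y Z x)
    (fun _ hZ ↦ koszul_tensorial_left hY hZ) (fun _ hX ↦ koszul_tensorial_right hX hY) hX hZ
  have h' : koszulForm Y x hY (X x) (Z x) = koszul X Y Z x := h
  simp only [leviCivitaFun, hY, dif_pos]
  simp [inner_smul_left, h']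

theorem ext_extend {x : M} {A B : TangentSpace I x →L[ℝ] TangentSpace I x}
    (h : ∀ X Z : Π x : M, TangentSpace I x, MDiffAt (T% X) x → MDiffAt (T% Z) x →
      (inner ℝ (A (X x)) (Z x) : ℝ) = inner ℝ (B (X x)) (Z x)) : A = B := by
  ext v
  refine ext_inner_right ℝ fun w ↦ ?_
  simpa using h (extend E v) (extend E w) (mdifferentiableAt_extend ..)
    (mdifferentiableAt_extend ..)

variable (I M) in
/-- The Levi-Civita connection `∇` of the Riemannian manifold `M`. As everywhere for Mathlib's
`CovariantDerivative`, `∇ Y x v` is `(∇_v Y)(x)`. -/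
def leviCivita : CovariantDerivative I E (fun x : M ↦ TangentSpace I x) where
  toFun := leviCivitaFun
  isCovariantDerivativeOnUniv :=
    { add := by
        intro Y Y' x hY hY' _
        have : CompleteSpace E := FiniteDimensional.complete ℝ E
        refine ext_extend fun X Z hX hZ ↦ ?_
        have hXY := inner_mdiff hX hY
        have hXY' := inner_mdiff hX hY'
        have hYZ := inner_mdiff hY hZ
        have hYZ' := inner_mdiff hY' hZ
        rw [inner_leviCivitaFun hX (mdifferentiableAt_add_section hY hY') hZ, add_apply, inner_add_left,
          inner_leviCivitaFun hX hY hZ, inner_leviCivitaFun hX hY' hZ]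
        simp [koszul, mlieBracket_add_left hY hY', mlieBracket_add_right hY hY', inner_add_left,
          inner_add_right, mvfderiv_fun_add hXY hXY', mvfderiv_fun_add hYZ hYZ']
        ring
      leibniz := by
        intro Y f x hY hf _
        have : CompleteSpace E := FiniteDimensional.complete ℝ E
        refine ext_extend fun X Z hX hZ ↦ ?_
        have hXY := inner_mdiff hX hY
        have hYZ := inner_mdiff hY hZ
        rw [inner_leviCivitaFun hX (hf.smul_section hY) hZ]
        simp [inner_add_left, inner_smul_left, inner_leviCivitaFun hX hY hZ]
        simp [koszul, mlieBracket_smul_left hf hY, mlieBracket_smul_right hf hY, inner_add_left,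
          inner_smul_left, inner_smul_right, mvfderiv_fun_mul hf hXY, mvfderiv_fun_mul hf hYZ]
        rw [real_inner_comm (X x) (Y x)]
        ring }


theorem inner_leviCivita {X Y Z : Π x : M, TangentSpace I x} {x : M}
    (hX : MDiffAt (T% X) x) (hY : MDiffAt (T% Y) x) (hZ : MDiffAt (T% Z) x) :
    inner ℝ (leviCivita I M Y x (X x)) (Z x) = 2⁻¹ * koszul X Y Z x :=
  inner_leviCivitaFun hX hY hZ

/-- The Levi-Civita connection is torsion free. -/
theorem leviCivita_torsion : (leviCivita I M).torsion = 0 := by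
  have : CompleteSpace E := FiniteDimensional.complete ℝ E
  rw [CovariantDerivative.torsion_eq_zero_iff]
  intro X Y x hX hY
  refine ext_inner_right ℝ fun w ↦ ?_
  have hZ : MDiffAt (T% (extend E w)) x := mdifferentiableAt_extend ..
  have h1 := inner_leviCivita hX hY hZ
  have h2 := inner_leviCivita hY hX hZ
  simp only [extend_apply_self] at h1 h2
  rw [inner_sub_left, h1, h2, koszul, koszul, mlieBracket_swap (V := Y) (W := X)]
  have h3 : (fun y ↦ (inner ℝ (Y y) (X y) : ℝ)) = fun y ↦ inner ℝ (X y) (Y y) := by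
    ext y; exact real_inner_comm _ _
  rw [h3]
  simp
  ring

/-- The Levi-Civita connection is a metric connection. -/
theorem leviCivita_isMetricCompatible :
    (leviCivita I M).IsMetricCompatible (V := fun x : M ↦ TangentSpace I x) := by
  have : CompleteSpace E := FiniteDimensional.complete ℝ E
  rw [CovariantDerivative.isMetricCompatible_iff]
  intro x X Y Z hX hY hZ
  have h1 := inner_leviCivita hX hY hZ
  have h2 := inner_leviCivita hX hZ hY
  rw [real_inner_comm] at h2
  beta_reduce
  rw [h1, h2, koszul, koszul, mlieBracket_swap (V := Z) (W := Y)]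
  have h3 : (fun y ↦ (inner ℝ (Z y) (Y y) : ℝ)) = fun y ↦ inner ℝ (Y y) (Z y) := by
    ext y; exact real_inner_comm _ _
  rw [h3]
  simp
  ring


variable (I M) in
/-- A smooth almost complex structure on `M` which is orthogonal for the Riemannian metric, i.e. the
datum which turns the Riemannian manifold `M` into an almost Hermitian manifold. -/
structure OrthogonalAlmostComplexStructure where
  toFun : Π x : M, TangentSpace I x →L[ℝ] TangentSpace I x
  contMDiff_toFun : ContMDiff I (I.prod 𝓘(ℝ, E →L[ℝ] E)) ∞
    (fun x ↦ TotalSpace.mk' (E →L[ℝ] E)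
      (E := fun x : M ↦ TangentSpace I x →L[ℝ] TangentSpace I x) x (toFun x))
  sq : ∀ (x : M) (v : TangentSpace I x), toFun x (toFun x v) = -v
  orthogonal : ∀ (x : M) (v w : TangentSpace I x),
    (inner ℝ (toFun x v) (toFun x w) : ℝ) = inner ℝ v w

instance : CoeFun (OrthogonalAlmostComplexStructure I M)
    (fun _ ↦ Π x : M, TangentSpace I x →L[ℝ] TangentSpace I x) :=
  ⟨OrthogonalAlmostComplexStructure.toFun⟩

variable (J : OrthogonalAlmostComplexStructure I M)

/-- `D` is the minimal `U(n)`-connection of the almost Hermitian manifold: a metric connection for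
which the almost complex structure is parallel (i.e. a `U(n)`-connection), and such that, for every
tangent vector `X`, the endomorphism `ξ_X = D_X - ∇_X` is orthogonal to the Lie algebra `𝔲(n)` of
all skew-symmetric endomorphisms `A` which commute with the almost complex structure. (The
endomorphism `ξ_X` is itself skew-symmetric, because `D` and `∇` are both metric.)
Mathlib's `D.difference ∇ x Y X` is `D_X Y - ∇_X Y = ξ_X Y`. -/
structure IsMinimalUnitaryConnection
    (D : CovariantDerivative I E (fun x : M ↦ TangentSpace I x)) : Prop where
  metric : D.IsMetricCompatible (V := fun x : M ↦ TangentSpace I x)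
  parallel : ∀ (Y : Π x : M, TangentSpace I x) (x : M), MDiffAt (T% Y) x →
    ∀ v : TangentSpace I x, D (fun y ↦ J y (Y y)) x v = J x (D Y x v)
  orthogonal : ∀ (x : M) (X : TangentSpace I x) (A : TangentSpace I x →ₗ[ℝ] TangentSpace I x),
    (∀ v w, (inner ℝ (A v) w : ℝ) = - inner ℝ v (A w)) → (∀ v, A (J x v) = J x (A v)) →
    ∑ i, (inner ℝ (D.difference (leviCivita I M) x (stdOrthonormalBasis ℝ (TangentSpace I x) i) X)
      (A (stdOrthonormalBasis ℝ (TangentSpace I x) i)) : ℝ) = 0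

theorem mdiff_J {Y : Π x : M, TangentSpace I x} {x : M} (hY : MDiffAt (T% Y) x) :
    MDiffAt (T% (fun y ↦ J y (Y y))) x :=
  MDifferentiableAt.clm_bundle_apply (𝕜 := ℝ) (F₁ := E) (F₂ := E) (b := fun y : M ↦ y)
    (E₁ := fun x : M ↦ TangentSpace I x) (E₂ := fun x : M ↦ TangentSpace I x)
    (J.contMDiff_toFun.mdifferentiableAt (by simp)) hY

theorem covDerivJ_tensorial (D : CovariantDerivative I E (fun x : M ↦ TangentSpace I x)) (x : M) :
    TensorialAt I E (fun Y : Π x : M, TangentSpace I x ↦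
      D (fun y ↦ J y (Y y)) x - J x ∘L D Y x) x where
  smul {f Y} hf hY := by
    have h : (fun y ↦ J y ((f • Y) y)) = f • fun y ↦ J y (Y y) := by ext y; simp
    rw [h, D.isCovariantDerivativeOn.leibniz (mdiff_J J hY) hf,
      D.isCovariantDerivativeOn.leibniz hY hf]
    ext v
    simp
    module
  add {Y Y'} hY hY' := by
    have h : (fun y ↦ J y ((Y + Y') y)) = (fun y ↦ J y (Y y)) + fun y ↦ J y (Y' y) := by
      ext y; simp
    rw [h, D.isCovariantDerivativeOn.add (mdiff_J J hY) (mdiff_J J hY'),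
      D.isCovariantDerivativeOn.add hY hY']
    ext v
    simp
    module

/-- `covDerivJ J D x Y X = (D_X J) Y` -/
def covDerivJ (D : CovariantDerivative I E (fun x : M ↦ TangentSpace I x)) (x : M) :
    TangentSpace I x →L[ℝ] TangentSpace I x →L[ℝ] TangentSpace I x :=
  TensorialAt.mkHom _ x (covDerivJ_tensorial J D x)

theorem covDerivJ_apply (D : CovariantDerivative I E (fun x : M ↦ TangentSpace I x)) {x : M}
    {Y : Π x : M, TangentSpace I x} (hY : MDiffAt (T% Y) x) (v : TangentSpace I x) :
    covDerivJ J D x (Y x) v = D (fun y ↦ J y (Y y)) x v - J x (D Y x v) := by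
  have := TensorialAt.mkHom_apply (covDerivJ_tensorial J D x) hY
  exact congr($this v)

theorem inner_J (x : M) (v w : TangentSpace I x) :
    (inner ℝ (J x v) w : ℝ) = - inner ℝ v (J x w) := by
  rw [← J.orthogonal x v (J x w), J.sq, inner_neg_right, neg_neg]

theorem covDerivJ_comp (D : CovariantDerivative I E (fun x : M ↦ TangentSpace I x)) {x : M}
    (w v : TangentSpace I x) :
    covDerivJ J D x (J x w) v = - J x (covDerivJ J D x w v) := by
  have hY : MDiffAt (T% (extend E w)) x := mdifferentiableAt_extend ..
  have h1 := covDerivJ_apply J D hY v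
  have h2 := covDerivJ_apply J D (mdiff_J J hY) v
  have h3 : (fun y ↦ J y (J y (extend E w y))) = (-1 : ℝ) • (extend E w : Π x : M, TangentSpace I x) := by
    ext y; simp [J.sq]
  rw [h3, D.isCovariantDerivativeOn.smul_const _ hY] at h2
  simp only [extend_apply_self] at h1 h2
  rw [h1, h2]
  simp [J.sq]
  abel

theorem covDerivJ_skew {D : CovariantDerivative I E (fun x : M ↦ TangentSpace I x)}
    (hD : D.IsMetricCompatible (V := fun x : M ↦ TangentSpace I x)) {x : M}
    (u w v : TangentSpace I x) :
    (inner ℝ (covDerivJ J D x u v) w : ℝ) = - inner ℝ u (covDerivJ J D x w v) := by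
  have hU : MDiffAt (T% (extend E u)) x := mdifferentiableAt_extend ..
  have hW : MDiffAt (T% (extend E w)) x := mdifferentiableAt_extend ..
  have h1 := covDerivJ_apply J D hU v
  have h2 := covDerivJ_apply J D hW v
  have h3 := hD.mvfderiv_inner_eq (extend E v) (mdiff_J J hU) hW
  have h4 := hD.mvfderiv_inner_eq (extend E v) hU (mdiff_J J hW)
  have h5 : (fun y ↦ (inner ℝ (J y (extend E u y)) (extend E w y) : ℝ))
      = fun y ↦ - inner ℝ (extend E u y) (J y (extend E w y)) := by
    ext y; exact inner_J J y _ _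
  rw [h5, mvfderiv_fun_neg] at h3
  simp only [extend_apply_self] at h1 h2 h3 h4
  simp only [neg_apply] at h3
  rw [h4] at h3
  rw [h1, h2, inner_sub_left, inner_sub_right, inner_J J x _ w]
  rw [inner_J J x u] at h3
  linarith

/-- `minimalForm J x Y X = -½ J (∇_X J) Y`. -/
def minimalForm (x : M) : TangentSpace I x →L[ℝ] TangentSpace I x →L[ℝ] TangentSpace I x :=
  (-2⁻¹ : ℝ) • (ContinuousLinearMap.compL ℝ _ _ _ (J x)) ∘L covDerivJ J (leviCivita I M) x


theorem minimalForm_apply (x : M) (Y X : TangentSpace I x) :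
    minimalForm J x Y X = (-2⁻¹ : ℝ) • J x (covDerivJ J (leviCivita I M) x Y X) := by
  simp [minimalForm]

theorem minimalForm_J (x : M) (Y X : TangentSpace I x) :
    minimalForm J x (J x Y) X = - J x (minimalForm J x Y X) := by
  simp [minimalForm_apply, covDerivJ_comp]

theorem minimalForm_skew (x : M) (Y Z X : TangentSpace I x) :
    (inner ℝ (minimalForm J x Y X) Z : ℝ) = - inner ℝ Y (minimalForm J x Z X) := by
  rw [minimalForm_apply, minimalForm_apply, inner_smul_left, inner_smul_right, inner_J J,
    covDerivJ_skew J leviCivita_isMetricCompatible, covDerivJ_comp]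
  simp

theorem difference_apply (D D' : CovariantDerivative I E (fun x : M ↦ TangentSpace I x)) {x : M}
    {Y : Π x : M, TangentSpace I x} (hY : MDiffAt (T% Y) x) (v : TangentSpace I x) :
    D.difference D' x (Y x) v = D Y x v - D' Y x v := by
  have := IsCovariantDerivativeOn.difference_apply D.isCovariantDerivativeOnUniv
    D'.isCovariantDerivativeOnUniv (x := x) (Set.mem_univ x) hY
  exact congr($this v)

/-- The minimal `U(n)`-connection exists. -/
theorem exists_isMinimalUnitaryConnection :
    ∃ D : CovariantDerivative I E (fun x : M ↦ TangentSpace I x),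
      IsMinimalUnitaryConnection J D := by
  refine ⟨(leviCivita I M).addOneForm (minimalForm J), ?_, ?_, ?_⟩
  · rw [CovariantDerivative.isMetricCompatible_iff]
    intro x X Y Z _ hY hZ
    have h := (leviCivita_isMetricCompatible (I := I) (M := M)).mvfderiv_inner_eq X hY hZ
    have h' := minimalForm_skew J x (Y x) (Z x) (X x)
    simp only [CovariantDerivative.addOneForm, add_apply, inner_add_left, inner_add_right] at h ⊢
    linarith
  · intro Y x hY v
    have h := covDerivJ_apply J (leviCivita I M) hY v
    have h' : (leviCivita I M) (fun y ↦ J y (Y y)) x v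
        = covDerivJ J (leviCivita I M) x (Y x) v + J x ((leviCivita I M) Y x v) := by
      rw [h]; abel
    simp only [CovariantDerivative.addOneForm, add_apply, map_add, minimalForm_J, h']
    simp only [minimalForm_apply, map_smul, J.sq]
    module
  · intro x X A hA hAJ
    set b := stdOrthonormalBasis ℝ (TangentSpace I x)
    have hdiff : ∀ w, ((leviCivita I M).addOneForm (minimalForm J)).difference (leviCivita I M) x w X
        = minimalForm J x w X := by
      intro w
      have hW : MDiffAt (T% (extend E w)) x := mdifferentiableAt_extend ..
      have := difference_apply ((leviCivita I M).addOneForm (minimalForm J)) (leviCivita I M) hW X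
      simpa [CovariantDerivative.addOneForm] using this
    let S : TangentSpace I x →ₗ[ℝ] TangentSpace I x :=
      { toFun := fun w ↦ minimalForm J x w X
        map_add' := by intro v w; simp
        map_smul' := by intro c v; simp }
    let K : TangentSpace I x →ₗ[ℝ] TangentSpace I x := (J x : TangentSpace I x →ₗ[ℝ] TangentSpace I x)
    have h1 : ∑ i, (inner ℝ (minimalForm J x (b i) X) (A (b i)) : ℝ)
        = - LinearMap.trace ℝ _ (A * S) := by
      rw [LinearMap.trace_eq_sum_inner _ b, ← Finset.sum_neg_distrib]
      refine Finset.sum_congr rfl fun i _ ↦ ?_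
      have h := hA (minimalForm J x (b i) X) (b i)
      have h' := real_inner_comm (b i) (A (minimalForm J x (b i) X))
      have h'' : (A * S) (b i) = A (minimalForm J x (b i) X) := rfl
      rw [h'']
      linarith
    have hKSK : K * S * K = S := by
      ext w
      simp [K, S, minimalForm_J, J.sq]
    have hKK : K * K = -1 := by
      ext w
      simp [K, J.sq]
    have hAK : A * K = K * A := by
      ext w
      simp [K, hAJ]
    have h2 : LinearMap.trace ℝ _ (A * S) = - LinearMap.trace ℝ _ (A * S) := by
      conv_lhs => rw [← hKSK, ← mul_assoc, LinearMap.trace_mul_comm, ← mul_assoc, ← mul_assoc, ← hAK,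
        mul_assoc A, hKK]
      simp
    simp only [hdiff]
    rw [h1]
    linarith

variable {J} in
/-- The minimal `U(n)`-connection is unique. -/
theorem IsMinimalUnitaryConnection.unique
    {D D' : CovariantDerivative I E (fun x : M ↦ TangentSpace I x)}
    (hD : IsMinimalUnitaryConnection J D) (hD' : IsMinimalUnitaryConnection J D')
    {Y : Π x : M, TangentSpace I x} {x : M} (hY : MDiffAt (T% Y) x) :
    D Y x = D' Y x := by
  ext v
  set b := stdOrthonormalBasis ℝ (TangentSpace I x)
  let B : TangentSpace I x →ₗ[ℝ] TangentSpace I x :=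
    { toFun := fun w ↦ D.difference (leviCivita I M) x w v - D'.difference (leviCivita I M) x w v
      map_add' := by intro v w; simp; abel
      map_smul' := by intro c v; simp [smul_sub] }
  have hB {Z : Π x : M, TangentSpace I x} (hZ : MDiffAt (T% Z) x) :
      B (Z x) = D Z x v - D' Z x v := by
    simp [B, difference_apply _ _ hZ]
  have hskew : ∀ u w, (inner ℝ (B u) w : ℝ) = - inner ℝ u (B w) := by
    intro u w
    have hU : MDiffAt (T% (extend E u)) x := mdifferentiableAt_extend ..
    have hW : MDiffAt (T% (extend E w)) x := mdifferentiableAt_extend ..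
    have h1 := hD.metric.mvfderiv_inner_eq (extend E v) hU hW
    have h2 := hD'.metric.mvfderiv_inner_eq (extend E v) hU hW
    have h3 := hB hU
    have h4 := hB hW
    simp only [extend_apply_self] at h1 h2 h3 h4
    rw [h3, h4, inner_sub_left, inner_sub_right]
    linarith
  have hcomm : ∀ w, B (J x w) = J x (B w) := by
    intro w
    have hW : MDiffAt (T% (extend E w)) x := mdifferentiableAt_extend ..
    have h3 := hB hW
    have h4 := hB (mdiff_J J hW)
    simp only [extend_apply_self] at h3 h4
    rw [h3, h4, hD.parallel _ x hW, hD'.parallel _ x hW, map_sub]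
  have h0 : ∑ i, ‖B (b i)‖ ^ 2 = 0 := by
    have h1 := hD.orthogonal x v B hskew hcomm
    have h2 := hD'.orthogonal x v B hskew hcomm
    rw [← sub_eq_zero.mpr (h1.trans h2.symm), ← Finset.sum_sub_distrib]
    refine Finset.sum_congr rfl fun i _ ↦ ?_
    rw [← inner_sub_left, ← real_inner_self_eq_norm_sq]
    rfl
  have hB0 : B = 0 := by
    refine b.toBasis.ext fun i ↦ ?_
    have := (Finset.sum_eq_zero_iff_of_nonneg (fun i _ ↦ sq_nonneg ‖B (b i)‖)).1 h0 i
      (Finset.mem_univ i)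
    simpa using this
  have := hB hY
  rw [hB0] at this
  exact (sub_eq_zero.1 (by simpa using this.symm))

/-- The minimal `U(n)`-connection `∇̃` of the almost Hermitian manifold. -/
def minimalUnitaryConnection : CovariantDerivative I E (fun x : M ↦ TangentSpace I x) :=
  Classical.choose (exists_isMinimalUnitaryConnection J)

theorem isMinimalUnitaryConnection_minimalUnitaryConnection :
    IsMinimalUnitaryConnection J (minimalUnitaryConnection J) :=
  Classical.choose_spec (exists_isMinimalUnitaryConnection J)

/-- The intrinsic torsion `ξ = ∇̃ - ∇` of the almost Hermitian manifold:
`intrinsicTorsion J x X Y = ξ_X Y`. -/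
def intrinsicTorsion (x : M) (X Y : TangentSpace I x) : TangentSpace I x :=
  (minimalUnitaryConnection J).difference (leviCivita I M) x Y X

/-- The tensor `Jξ`, i.e. `(Jξ)_X Y = J (ξ_X Y)`. -/
def complexIntrinsicTorsion (x : M) (X Y : TangentSpace I x) : TangentSpace I x :=
  J x (intrinsicTorsion J x X Y)

/-- The covariant derivative of a tensor field `B` of type `(1, 2)`, written `(X, Y) ↦ B_X Y`, with
respect to the connection `D`:
`(D_v B)_a b = D_v (B_A C) - B_{D_v A} b - B_a (D_v C)`,
where `A` and `C` are any differentiable vector fields with `A x = a` and `C x = b`. The value does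
not depend on the extensions, so Mathlib's `FiberBundle.extend` is used. -/
def covDerivTensor (D : CovariantDerivative I E (fun x : M ↦ TangentSpace I x))
    (B : Π x : M, TangentSpace I x → TangentSpace I x → TangentSpace I x) (x : M)
    (v a b : TangentSpace I x) : TangentSpace I x :=
  D (fun y ↦ B y (extend E a y) (extend E b y)) x v
    - B x (D (extend E a) x v) b - B x a (D (extend E b) x v)

/-- The Riemannian curvature tensor with the sign convention
`R_{U,V} = ∇_{[U,V]} - (∇_U ∇_V - ∇_V ∇_U)`, so that `curvature x u v w = R_{u,v} w`. The value at
`x` depends only on the values at `x` of the vector fields `U`, `V`, `W`, so it may be computed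
from the extensions `FiberBundle.extend` of `u`, `v`, `w`. -/
def curvature (x : M) (u v w : TangentSpace I x) : TangentSpace I x :=
  let U : Π y : M, TangentSpace I y := extend E u
  let V : Π y : M, TangentSpace I y := extend E v
  let W : Π y : M, TangentSpace I y := extend E w
  leviCivita I M W x (mlieBracket I U V x)
    - (leviCivita I M (fun y ↦ leviCivita I M W y (V y)) x (U x)
      - leviCivita I M (fun y ↦ leviCivita I M W y (U y)) x (V x))

/-- The Ricci curvature `Ric(X, Y) = ∑ i, ⟨R_{X,e_i} Y, e_i⟩`, where `e_i` is an orthonormal basis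
of the tangent space. -/
def ricci (x : M) (X Y : TangentSpace I x) : ℝ :=
  ∑ i, inner ℝ (curvature x X (stdOrthonormalBasis ℝ (TangentSpace I x) i) Y)
    (stdOrthonormalBasis ℝ (TangentSpace I x) i)

/-- The `*`-Ricci curvature `Ric*(X, Y) = ∑ i, ⟨R_{X,e_i} JY, J e_i⟩`, where `e_i` is an
orthonormal basis of the tangent space. -/
def ricciStar (x : M) (X Y : TangentSpace I x) : ℝ :=
  ∑ i, inner ℝ (curvature x X (stdOrthonormalBasis ℝ (TangentSpace I x) i) (J x Y))
    (J x (stdOrthonormalBasis ℝ (TangentSpace I x) i))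

/-- The Hermitian part `b_H` of a bilinear form `b` on the tangent space at `x`, i.e. its component
with `b_H(JX, JY) = b_H(X, Y)`. -/
def hermitianPart {x : M} (b : TangentSpace I x → TangentSpace I x → ℝ)
    (X Y : TangentSpace I x) : ℝ :=
  (b X Y + b (J x X) (J x Y)) / 2

/-- The anti-Hermitian part `b_AH` of a bilinear form `b` on the tangent space at `x`, i.e. its
component with `b_AH(JX, JY) = -b_AH(X, Y)`. -/
def antiHermitianPart {x : M} (b : TangentSpace I x → TangentSpace I x → ℝ)
    (X Y : TangentSpace I x) : ℝ :=
  (b X Y - b (J x X) (J x Y)) / 2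

end AlmostHermitian

end

noncomputable section

namespace AlmostHermitian

variable {E : Type*} [NormedAddCommGroup E] [NormedSpace ℝ E] [FiniteDimensional ℝ E]
  {H : Type*} [TopologicalSpace H] {I : ModelWithCorners ℝ E H}
  {M : Type*} [TopologicalSpace M] [ChartedSpace H M] [IsManifold I ∞ M]
  [RiemannianBundle (fun x : M ↦ TangentSpace I x)]
  [IsContMDiffRiemannianBundle I ∞ E (fun x : M ↦ TangentSpace I x)]

open Filter Topology

/-! Since `ξ_X` is orthogonal to `𝔲(n)`, it anticommutes with `J`; together with `∇̃J = 0` this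
gives `(∇_X J)Y = 2 J ξ_X Y` (`covDerivJ_leviCivita`). So `2Jξ = ∇J`, and antisymmetrising its
covariant derivative is the Ricci identity for `J`: the result is the commutator of the curvature
with `J` (`two_smul_covDerivTensor_sub_swap`). Evaluated on `JY` and contracted with `e_i`, that
commutator is `Ric* - Ric`. Substituting `∇ = ∇̃ - ξ` gives the second form of (1): the terms `ξ_v
ξ_a + ξ_a ξ_v` are symmetric in `v`, `a` and drop out.

Part (2) is linear algebra over (1) with three symmetries: `Ric` is symmetric, `Ric*(JX, JY) =
Ric*(Y, X)`, and the contraction of `ξ_{ξ_{e_i} X} Y` is symmetric in `X`, `Y`, being the trace of a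
product of two endomorphisms.

The analytic burden is that `curvature` and `covDerivTensor` are computed from chosen extensions,
and `J` applied to the extension of `b` is not the chosen extension of `J b`. Independence of the
extension is obtained from skew-symmetry: `⟨R_{U,V} W, Z⟩ = -⟨W, R_{U,V} Z⟩` shows that `W` matters
only through its value at the point, and the same holds for `∇(Jξ)`. All fields are taken `C²` at
the point, which is enough for two covariant derivatives. -/

/-! ### Differentiability of `∇_X Y` for `C²` vector fields. -/

theorem contMDiffAt_inner {X Y : Π x : M, TangentSpace I x} {x : M}
    (hX : CMDiffAt 2 (T% X) x) (hY : CMDiffAt 2 (T% Y) x) :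
    CMDiffAt 2 (fun y ↦ (inner ℝ (X y) (Y y) : ℝ)) x :=
  ContMDiffAt.inner_bundle (E := fun x : M ↦ TangentSpace I x) (b := fun y : M ↦ y) (IB := I)
    (F := E) (v := X) (w := Y) hX hY

theorem eventually_contMDiffAt {X : Π x : M, TangentSpace I x} {x : M}
    (hX : CMDiffAt 2 (T% X) x) : ∀ᶠ y in 𝓝 x, CMDiffAt 2 (T% X) y :=
  (contMDiffAt_iff_contMDiffAt_nhds (by simp)).1 hX

theorem eventually_mdifferentiableAt {X : Π x : M, TangentSpace I x} {x : M}
    (hX : CMDiffAt 2 (T% X) x) : ∀ᶠ y in 𝓝 x, MDiffAt (T% X) y := by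
  filter_upwards [eventually_contMDiffAt hX] with y hy using hy.mdifferentiableAt (by simp)

theorem mdifferentiableAt_mvfderiv {f : M → ℝ} {V : Π x : M, TangentSpace I x} {x : M}
    (hf : CMDiffAt 2 f x) (hV : CMDiffAt 2 (T% V) x) :
    MDiffAt (fun y ↦ d% f y (V y)) x := by
  have h1 : CMDiffAt 1 (fun y ↦ ContinuousLinearMap.inCoordinates E (TangentSpace I (M := M)) ℝ
        (TangentSpace 𝓘(ℝ, ℝ) (M := ℝ)) x y (f x) (f y) (mfderiv% f y)) x :=
    ContMDiffAt.mfderiv_const hf (by norm_num)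
  have h2 := ContMDiffAt.clm_apply_of_inCoordinates h1 (hV.of_le (by norm_num))
    (hf.of_le (by norm_num))
  exact ((contMDiff_snd_tangentBundle_modelSpace ℝ 𝓘(ℝ, ℝ)).contMDiffAt.comp x
    h2).mdifferentiableAt one_ne_zero

theorem mdifferentiableAt_mlieBracket {U V : Π x : M, TangentSpace I x} {x : M}
    (hU : CMDiffAt 2 (T% U) x) (hV : CMDiffAt 2 (T% V) x) :
    MDiffAt (T% (mlieBracket I U V)) x := by
  have : CompleteSpace E := FiniteDimensional.complete ℝ E
  have : IsManifold I (minSmoothness ℝ 2) M := by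
    rw [minSmoothness_of_isRCLikeNormedField]; infer_instance
  have : IsManifold I (((2 : ℕ∞) : ℕ∞ω) + 1) M := IsManifold.of_le (n := ∞)
    (by exact_mod_cast le_top)
  exact (ContMDiffAt.mlieBracket_vectorField (m := 1) (n := 2) hU hV
    (by simp; norm_num)).mdifferentiableAt (by simp)

theorem mdifferentiableAt_koszul {X Y Z : Π x : M, TangentSpace I x} {x : M}
    (hX : CMDiffAt 2 (T% X) x) (hY : CMDiffAt 2 (T% Y) x) (hZ : CMDiffAt 2 (T% Z) x) :
    MDiffAt (koszul X Y Z) x := by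
  have mX := hX.mdifferentiableAt (by simp)
  have mY := hY.mdifferentiableAt (by simp)
  have mZ := hZ.mdifferentiableAt (by simp)
  exact (((((mdifferentiableAt_mvfderiv (contMDiffAt_inner hY hZ) hX).add
    (mdifferentiableAt_mvfderiv (contMDiffAt_inner hX hZ) hY)).sub
    (mdifferentiableAt_mvfderiv (contMDiffAt_inner hX hY) hZ)).add
    (inner_mdiff (mdifferentiableAt_mlieBracket hX hY) mZ)).sub
    (inner_mdiff (mdifferentiableAt_mlieBracket hX hZ) mY)).sub
    (inner_mdiff (mdifferentiableAt_mlieBracket hY hZ) mX)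

/-- Cramer's rule: the entries of the inverse are cofactors over the determinant, hence rational
functions of the matrix entries. -/
theorem differentiableAt_inv_mulVec {ι : Type*} [Fintype ι] [DecidableEq ι]
    (p : (ι → ι → ℝ) × (ι → ℝ)) (hp : (Matrix.of p.1).det ≠ 0) (i : ι) :
    DifferentiableAt ℝ (fun q : (ι → ι → ℝ) × (ι → ℝ) ↦
      ((Matrix.of q.1)⁻¹.mulVec q.2) i) p := by
  have hent : ∀ i j, DifferentiableAt ℝ (fun q : (ι → ι → ℝ) × (ι → ℝ) ↦ q.1 i j) p := by
    intro i j; fun_prop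
  have hdet : ∀ A : ((ι → ι → ℝ) × (ι → ℝ)) → Matrix ι ι ℝ,
      (∀ i j, DifferentiableAt ℝ (fun q ↦ A q i j) p) →
      DifferentiableAt ℝ (fun q ↦ (A q).det) p := by
    intro A hA
    simp only [Matrix.det_apply']
    fun_prop
  have hadj : ∀ i j, DifferentiableAt ℝ (fun q : (ι → ι → ℝ) × (ι → ℝ) ↦
      (Matrix.of q.1).adjugate i j) p := by
    intro i j
    simp only [Matrix.adjugate_apply]
    refine hdet _ fun k l ↦ ?_
    by_cases h : k = j
    · subst h; simp
    · simpa [Matrix.updateRow_apply, h] using hent k l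
  have hd := hdet (fun q ↦ Matrix.of q.1) hent
  simp only [Matrix.inv_def, Matrix.mulVec, dotProduct, Matrix.smul_apply, Ring.inverse_eq_inv,
    smul_eq_mul]
  fun_prop (disch := exact hp)

theorem mdifferentiableAt_pi_space {ι : Type*} [Fintype ι] {f : M → ι → ℝ} {x : M}
    (h : ∀ i, MDiffAt (fun y ↦ f y i) x) : MDifferentiableAt I 𝓘(ℝ, ι → ℝ) f x := by
  refine mdifferentiableAt_iff _ _ |>.2 ⟨continuousAt_pi.2 fun i ↦ (h i).continuousAt,
    differentiableWithinAt_pi.2 fun i ↦ ?_⟩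
  exact ((mdifferentiableAt_iff _ _).1 (h i)).2

/-- In a local frame the inner products of `σ` with the frame are the Gram matrix applied to the
coefficients of `σ`. Inverting the Gram matrix, which is differentiable and nonsingular, recovers
differentiable coefficients. This suits `∇_X Y`, which Koszul's formula describes only through its
inner products. -/
theorem mdifferentiableAt_of_inner {σ : Π x : M, TangentSpace I x} {x : M}
    (h : ∀ Z : Π x : M, TangentSpace I x, CMDiffAt 2 (T% Z) x →
      MDiffAt (fun y ↦ (inner ℝ (σ y) (Z y) : ℝ)) x) : MDiffAt (T% σ) x := by
  classical
  let t := trivializationAt E (fun x : M ↦ TangentSpace I x) x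
  let b := Module.finBasis ℝ E
  have hx : x ∈ t.baseSet := mem_baseSet_trivializationAt _ _ x
  have hs := t.isLocalFrameOn_localFrame_baseSet I 2 b
  have hs1 := t.isLocalFrameOn_localFrame_baseSet I 1 b
  have hsx : ∀ i, CMDiffAt 2 (T% (t.localFrame b i)) x := fun i ↦ hs.contMDiffAt t.open_baseSet hx i
  refine hs1.mdifferentiableAt_of_coeff (fun i ↦ ?_) (t.open_baseSet.mem_nhds hx)
  let G : M → Fin (Module.finrank ℝ E) → Fin (Module.finrank ℝ E) → ℝ :=
    fun y j k ↦ inner ℝ (t.localFrame b j y) (t.localFrame b k y)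
  let c : M → Fin (Module.finrank ℝ E) → ℝ := fun y j ↦ inner ℝ (σ y) (t.localFrame b j y)
  have hdet : ∀ y ∈ t.baseSet, (Matrix.of (G y)).det ≠ 0 := fun y hy ↦
    (Matrix.det_gram_ne_zero_iff_linearIndependent (𝕜 := ℝ)).2 (hs.linearIndependent hy)
  have hG : MDifferentiableAt I 𝓘(ℝ, (Fin (Module.finrank ℝ E) → Fin (Module.finrank ℝ E) → ℝ) ×
      (Fin (Module.finrank ℝ E) → ℝ)) (fun y ↦ (G y, c y)) x := by
    refine MDifferentiableAt.prodMk_space ?_ ?_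
    · exact (contMDiffAt_pi_space.2 fun j ↦ contMDiffAt_pi_space.2 fun k ↦
        contMDiffAt_inner (hsx j) (hsx k)).mdifferentiableAt (n := 2) (by simp)
    · exact mdifferentiableAt_pi_space fun j ↦ h _ (hsx j)
  have hF := (differentiableAt_inv_mulVec (G x, c x) (hdet x hx) i).mdifferentiableAt
  refine (MDifferentiableAt.comp (f := fun y ↦ (G y, c y)) x hF hG).congr_of_eventuallyEq ?_
  filter_upwards [t.open_baseSet.mem_nhds hx] with y hy
  have h1 := hs1.coeff_sum_eq σ hy
  have h2 : c y = (Matrix.of (G y)).mulVec (fun j ↦ hs1.coeff j y (σ y)) := by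
    ext j
    conv_lhs => simp only [c]; rw [h1]
    simp only [Matrix.mulVec, dotProduct, G, sum_inner, inner_smul_left, Matrix.of_apply]
    refine Finset.sum_congr rfl fun k _ ↦ ?_
    rw [real_inner_comm]
    simp [mul_comm]
  simp only [Function.comp_apply, h2, Matrix.mulVec_mulVec]
  rw [Matrix.nonsing_inv_mul _ (isUnit_iff_ne_zero.2 (hdet y hy)), Matrix.one_mulVec]
  rfl

theorem mdifferentiableAt_leviCivita {X Y : Π x : M, TangentSpace I x} {x : M}
    (hX : CMDiffAt 2 (T% X) x) (hY : CMDiffAt 2 (T% Y) x) :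
    MDiffAt (T% (fun y ↦ leviCivita I M Y y (X y))) x := by
  refine mdifferentiableAt_of_inner fun Z hZ ↦ ?_
  refine ((mdifferentiableAt_const (c := (2⁻¹ : ℝ))).mul
    (mdifferentiableAt_koszul hX hY hZ)).congr_of_eventuallyEq ?_
  filter_upwards [eventually_mdifferentiableAt hX, eventually_mdifferentiableAt hY,
    eventually_mdifferentiableAt hZ] with y h1 h2 h3
  exact inner_leviCivita h1 h2 h3

/-! ### Commutators of derivations and curvature on vector fields. -/

/-- Derivatives of functions along vector fields satisfy `U (V f) - V (U f) = [U, V] f`. -/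
theorem mvfderiv_mlieBracket {f : M → ℝ} {U V : Π x : M, TangentSpace I x} {x : M}
    (hf : CMDiffAt 2 f x) (hU : CMDiffAt 2 (T% U) x) (hV : CMDiffAt 2 (T% V) x) :
    d% f x (mlieBracket I U V x)
      = d% (fun y ↦ d% f y (V y)) x (U x) - d% (fun y ↦ d% f y (U y)) x (V x) := by
  have : CompleteSpace E := FiniteDimensional.complete ℝ E
  have : IsManifold I (minSmoothness ℝ 2) M := by
    rw [minSmoothness_of_isRCLikeNormedField]; infer_instance
  have : IsManifold I (minSmoothness ℝ 3) M := by
    rw [minSmoothness_of_isRCLikeNormedField]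
    exact IsManifold.of_le (n := ∞) (WithTop.coe_le_coe.2 le_top)
  -- The identity is read off as the coefficient of a nonzero vector `w`, so the zero tangent space
  -- is treated apart.
  rcases subsingleton_or_nontrivial (TangentSpace I x) with h0 | h0
  · rw [Subsingleton.elim (mlieBracket I U V x) 0, Subsingleton.elim (U x) 0,
      Subsingleton.elim (V x) 0]
    simp
  obtain ⟨w, hw⟩ := exists_ne (0 : TangentSpace I x)
  let W : Π y : M, TangentSpace I y := extend E w
  have hW : CMDiffAt 2 (T% W) x := contMDiffAt_extend ..
  have hfW : CMDiffAt 2 (T% (f • W)) x := hf.smul_section hW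
  -- Jacobi's identity is compared for `W` and for `f W`. Expanding by the Leibniz rule, the terms
  -- with first derivatives of `f` times brackets with `W` cancel, and the coefficient of `w` is the
  -- claim.
  have bracket_smul : ∀ {A : Π y : M, TangentSpace I y} {B : Π y : M, TangentSpace I y},
      CMDiffAt 2 (T% A) x → CMDiffAt 2 (T% B) x →
      mlieBracket I B (mlieBracket I A (f • W)) x
        = d% (fun y ↦ d% f y (A y)) x (B x) • w + d% f x (A x) • mlieBracket I B W x
          + (d% f x (B x) • mlieBracket I A W x + f x • mlieBracket I B (mlieBracket I A W) x) := by
    intro A B hA hB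
    have hev : mlieBracket I A (f • W) =ᶠ[𝓝 x]
        (fun y ↦ d% f y (A y)) • W + f • mlieBracket I A W := by
      filter_upwards [(contMDiffAt_iff_contMDiffAt_nhds (by simp)).1 hf,
        eventually_mdifferentiableAt hW] with y h1 h2
      exact mlieBracket_smul_right (h1.mdifferentiableAt (by simp)) h2
    have hAf := mdifferentiableAt_mvfderiv hf hA
    have hAW := mdifferentiableAt_mlieBracket hA hW
    have mf : MDiffAt f x := hf.mdifferentiableAt (by simp)
    have mW : MDiffAt (T% W) x := hW.mdifferentiableAt (by simp)
    rw [EventuallyEq.rfl.mlieBracket_vectorField_eq hev,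
      mlieBracket_add_right (hAf.smul_section mW) (mf.smul_section hAW),
      mlieBracket_smul_right hAf mW, mlieBracket_smul_right mf hAW]
    simp [W]
  have jac := leibniz_identity_mlieBracket_apply (I := I) (U := U) (V := V) (W := W)
    (by simpa using hU) (by simpa using hV) (by simpa using hW)
  have jac' := leibniz_identity_mlieBracket_apply (I := I) (U := U) (V := V) (W := f • W)
    (by simpa using hU) (by simpa using hV) (by simpa using hfW)
  rw [bracket_smul hV hU, bracket_smul hU hV, mlieBracket_smul_right
    (hf.mdifferentiableAt (by simp)) (hW.mdifferentiableAt (by simp)), jac] at jac'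
  have hWx : W x = w := by simp [W]
  rw [hWx] at jac'
  have key : (d% f x (mlieBracket I U V x) - (d% (fun y ↦ d% f y (V y)) x (U x)
      - d% (fun y ↦ d% f y (U y)) x (V x))) • w = 0 := by
    linear_combination (norm := module) -jac'
  exact sub_eq_zero.1 ((smul_eq_zero.1 key).resolve_right hw)

theorem mvfderiv_congr {f g : M → ℝ} {x : M} (h : f =ᶠ[𝓝 x] g) : d% f x = d% g x := by
  ext v
  simp only [mvfderiv, ContinuousLinearMap.comp_apply]
  rw [h.mfderiv_eq]
  rfl

theorem leviCivita_congr {X Y : Π x : M, TangentSpace I x} {x : M}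
    (hX : MDiffAt (T% X) x) (h : ∀ᶠ y in 𝓝 x, X y = Y y) :
    leviCivita I M X x = leviCivita I M Y x := by
  have hY : MDiffAt (T% Y) x :=
    hX.congr_of_eventuallyEq (h.mono fun y hy ↦ by simp [hy])
  exact (leviCivita I M).isCovariantDerivativeOnUniv.congr_of_eventuallyEq hX hY univ_mem h

theorem leviCivita_sub_swap {X Y : Π x : M, TangentSpace I x} {x : M}
    (hX : MDiffAt (T% X) x) (hY : MDiffAt (T% Y) x) :
    leviCivita I M Y x (X x) - leviCivita I M X x (Y x) = mlieBracket I X Y x := by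
  have : CompleteSpace E := FiniteDimensional.complete ℝ E
  exact (CovariantDerivative.torsion_eq_zero_iff _).1 (leviCivita_torsion (I := I) (M := M)) hX hY

theorem leviCivita_sub {X Y : Π x : M, TangentSpace I x} {x : M}
    (hX : MDiffAt (T% X) x) (hY : MDiffAt (T% Y) x) :
    leviCivita I M (fun y ↦ X y - Y y) x = leviCivita I M X x - leviCivita I M Y x := by
  have hY' : MDiffAt (T% ((-1 : ℝ) • Y)) x :=
    (mdifferentiableAt_const (c := (-1 : ℝ))).smul_section hY
  have h1 := (leviCivita I M).isCovariantDerivativeOnUniv.add hX hY' (Set.mem_univ x)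
  rw [(leviCivita I M).isCovariantDerivativeOnUniv.smul_const _ hY] at h1
  have h2 : (fun y ↦ X y - Y y) = X + (-1 : ℝ) • Y := by
    ext y; simp [sub_eq_add_neg]
  rw [h2, sub_eq_add_neg]
  simpa using h1

/-- The Riemannian curvature tensor applied to vector fields. -/
def curvatureField (U V W : Π x : M, TangentSpace I x) (x : M) : TangentSpace I x :=
  leviCivita I M W x (mlieBracket I U V x)
    - (leviCivita I M (fun y ↦ leviCivita I M W y (V y)) x (U x)
      - leviCivita I M (fun y ↦ leviCivita I M W y (U y)) x (V x))

theorem curvatureField_swap (U V W : Π x : M, TangentSpace I x) (x : M) :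
    curvatureField V U W x = - curvatureField U V W x := by
  rw [curvatureField, curvatureField, mlieBracket_swap_apply, map_neg]
  abel

theorem mvfderiv_mvfderiv_inner {U V W Z : Π x : M, TangentSpace I x} {x : M}
    (hV : CMDiffAt 2 (T% V) x) (hW : CMDiffAt 2 (T% W) x) (hZ : CMDiffAt 2 (T% Z) x) :
    d% (fun y ↦ d% (fun z ↦ (inner ℝ (W z) (Z z) : ℝ)) y (V y)) x (U x)
      = inner ℝ (leviCivita I M (fun y ↦ leviCivita I M W y (V y)) x (U x)) (Z x)
        + inner ℝ (leviCivita I M W x (V x)) (leviCivita I M Z x (U x))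
        + (inner ℝ (leviCivita I M W x (U x)) (leviCivita I M Z x (V x))
          + inner ℝ (W x) (leviCivita I M (fun y ↦ leviCivita I M Z y (V y)) x (U x))) := by
  have hm := leviCivita_isMetricCompatible (I := I) (M := M)
  have h : (fun y ↦ d% (fun z ↦ (inner ℝ (W z) (Z z) : ℝ)) y (V y)) =ᶠ[𝓝 x]
      fun y ↦ inner ℝ (leviCivita I M W y (V y)) (Z y)
        + inner ℝ (W y) (leviCivita I M Z y (V y)) := by
    filter_upwards [eventually_mdifferentiableAt hW, eventually_mdifferentiableAt hZ] with y h1 h2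
    exact hm.mvfderiv_inner_eq V h1 h2
  have mW := hW.mdifferentiableAt (by simp)
  have mZ := hZ.mdifferentiableAt (by simp)
  have mVW := mdifferentiableAt_leviCivita hV hW
  have mVZ := mdifferentiableAt_leviCivita hV hZ
  rw [mvfderiv_congr h, mvfderiv_fun_add (inner_mdiff mVW mZ) (inner_mdiff mW mVZ), add_apply]
  exact congr($(hm.mvfderiv_inner_eq U mVW mZ) + $(hm.mvfderiv_inner_eq U mW mVZ))

/-- Apply `U V - V U = [U, V]` to the function `⟨W, Z⟩` and use metric compatibility: the mixed
terms `⟨∇_V W, ∇_U Z⟩ + ⟨∇_U W, ∇_V Z⟩` are symmetric in `U`, `V` and cancel. -/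
theorem inner_curvatureField {U V W Z : Π x : M, TangentSpace I x} {x : M}
    (hU : CMDiffAt 2 (T% U) x) (hV : CMDiffAt 2 (T% V) x) (hW : CMDiffAt 2 (T% W) x)
    (hZ : CMDiffAt 2 (T% Z) x) :
    (inner ℝ (curvatureField U V W x) (Z x) : ℝ) = - inner ℝ (W x) (curvatureField U V Z x) := by
  have h1 := mvfderiv_mlieBracket (contMDiffAt_inner hW hZ) hU hV
  rw [mvfderiv_mvfderiv_inner hV hW hZ, mvfderiv_mvfderiv_inner hU hW hZ] at h1
  have h2 := leviCivita_isMetricCompatible.mvfderiv_inner_eq (mlieBracket I U V)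
    (hW.mdifferentiableAt (by simp)) (hZ.mdifferentiableAt (by simp))
  beta_reduce at h2
  rw [h1] at h2
  simp only [curvatureField, inner_sub_left, inner_sub_right]
  linarith

theorem curvatureField_cyclic {U V W : Π x : M, TangentSpace I x} {x : M}
    (hU : CMDiffAt 2 (T% U) x) (hV : CMDiffAt 2 (T% V) x) (hW : CMDiffAt 2 (T% W) x) :
    curvatureField U V W x + curvatureField V W U x + curvatureField W U V x = 0 := by
  have : CompleteSpace E := FiniteDimensional.complete ℝ E
  have : IsManifold I (minSmoothness ℝ 3) M := by
    rw [minSmoothness_of_isRCLikeNormedField]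
    exact IsManifold.of_le (n := ∞) (WithTop.coe_le_coe.2 le_top)
  -- Vanishing torsion is used twice: on `B`, `C`, and then on `A`, `[B, C]`. The cyclic sum then
  -- reduces to Jacobi's identity.
  have key : ∀ {A B C : Π x : M, TangentSpace I x}, CMDiffAt 2 (T% A) x → CMDiffAt 2 (T% B) x →
      CMDiffAt 2 (T% C) x →
      leviCivita I M (fun y ↦ leviCivita I M C y (B y)) x (A x)
        - leviCivita I M (fun y ↦ leviCivita I M B y (C y)) x (A x)
        - leviCivita I M A x (mlieBracket I B C x) = mlieBracket I A (mlieBracket I B C) x := by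
    intro A B C hA hB hC
    have m1 := mdifferentiableAt_leviCivita hB hC
    have m2 := mdifferentiableAt_leviCivita hC hB
    have m3 := mdifferentiableAt_mlieBracket hB hC
    have h : ∀ᶠ y in 𝓝 x, mlieBracket I B C y
        = leviCivita I M C y (B y) - leviCivita I M B y (C y) := by
      filter_upwards [eventually_mdifferentiableAt hB, eventually_mdifferentiableAt hC]
        with y h1 h2
      exact (leviCivita_sub_swap h1 h2).symm
    rw [← leviCivita_sub_swap (hA.mdifferentiableAt (by simp)) m3, leviCivita_congr m3 h,
      leviCivita_sub m1 m2]
    rfl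
  have jac := leibniz_identity_mlieBracket_apply (I := I) (U := U) (V := V) (W := W)
    (by simpa using hU) (by simpa using hV) (by simpa using hW)
  have s1 : mlieBracket I V (mlieBracket I U W) x = - mlieBracket I V (mlieBracket I W U) x := by
    rw [mlieBracket_swap (V := U)]
    have := mlieBracket_const_smul_right (I := I) (V := V) (c := (-1 : ℝ))
      (mdifferentiableAt_mlieBracket hW hU)
    simpa using this
  rw [mlieBracket_swap_apply (V := mlieBracket I U V), s1] at jac
  have k1 := key hU hV hW
  have k2 := key hV hW hU
  have k3 := key hW hU hV
  simp only [curvatureField]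
  linear_combination (norm := module) -k1 - k2 - k3 - jac

/-! ### Algebraic symmetries of the curvature tensor. -/

section Curvature

variable {x : M} (u v w z : TangentSpace I x)

theorem curvature_swap : curvature x v u w = - curvature x u v w :=
  curvatureField_swap _ _ _ _

theorem inner_curvature_comm :
    (inner ℝ (curvature x u v w) z : ℝ) = - inner ℝ (curvature x u v z) w := by
  have h := inner_curvatureField (x := x) (U := extend E u) (V := extend E v) (W := extend E w)
    (Z := extend E z) (contMDiffAt_extend ..) (contMDiffAt_extend ..) (contMDiffAt_extend ..)
    (contMDiffAt_extend ..)
  rw [extend_apply_self, extend_apply_self, real_inner_comm _ w] at h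
  exact h

/-- Tensoriality in the last argument: skew-symmetry moves all differentiation from `W` onto the
extension of `z`, leaving only `W x`. -/
theorem inner_curvatureField_extend {W : Π x : M, TangentSpace I x} (hW : CMDiffAt 2 (T% W) x) :
    (inner ℝ (curvatureField (extend E u) (extend E v) W x) z : ℝ)
      = inner ℝ (curvature x u v (W x)) z := by
  have h := inner_curvatureField (x := x) (U := extend E u) (V := extend E v) (W := W)
    (Z := extend E z) (contMDiffAt_extend ..) (contMDiffAt_extend ..) hW
    (contMDiffAt_extend ..)
  rw [extend_apply_self] at h
  rw [h, inner_curvature_comm, real_inner_comm]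
  rfl

theorem curvature_cyclic : curvature x u v w + curvature x v w u + curvature x w u v = 0 :=
  curvatureField_cyclic (contMDiffAt_extend ..) (contMDiffAt_extend ..) (contMDiffAt_extend ..)

/-- A linear consequence of the Bianchi identities for the four cyclic rotations of `(u, v, w, z)`
and of skew-symmetry in each pair. Besides the symmetry of `Ric`, it yields linearity of the
curvature in `v`, by moving `v` to the free slot of the inner product. -/
theorem inner_curvature_pair_comm :
    (inner ℝ (curvature x u v w) z : ℝ) = inner ℝ (curvature x w z u) v := by
  have cyc : ∀ a b c d : TangentSpace I x, (inner ℝ (curvature x a b c) d : ℝ)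
      + inner ℝ (curvature x b c a) d + inner ℝ (curvature x c a b) d = 0 := by
    intro a b c d
    rw [← inner_add_left, ← inner_add_left, curvature_cyclic, inner_zero_left]
  have sw : ∀ a b c d : TangentSpace I x, (inner ℝ (curvature x b a c) d : ℝ)
      = - inner ℝ (curvature x a b c) d := by
    intro a b c d
    rw [curvature_swap, inner_neg_left]
  have h1 := cyc u v w z
  have h2 := cyc v w z u
  have h3 := cyc w z u v
  have h4 := cyc z u v w
  have := inner_curvature_comm u v w z
  have := inner_curvature_comm v w u z
  have := inner_curvature_comm w u v z
  have := inner_curvature_comm w z u v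
  have := inner_curvature_comm z u w v
  have := inner_curvature_comm v z w u
  have := sw u z w v
  have := sw w u v z
  have := sw v z w u
  have := sw u z v w
  have := sw u w v z
  have := sw u w z v
  have := sw v z u w
  linarith

/-- The linear map `v ↦ R_{u,v} w`. -/
def curvatureMap : TangentSpace I x →ₗ[ℝ] TangentSpace I x where
  toFun v := curvature x u v w
  map_add' v v' := ext_inner_right ℝ fun z ↦ by
    simp only [inner_add_left, inner_curvature_pair_comm u _ w, inner_add_right]
  map_smul' c v := ext_inner_right ℝ fun z ↦ by
    simp only [inner_smul_left, inner_curvature_pair_comm u _ w, inner_smul_right]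
    simp

theorem curvature_neg : curvature x u v (-w) = - curvature x u v w :=
  ext_inner_right ℝ fun z ↦ by
    rw [inner_curvature_comm, inner_neg_right, inner_neg_left, inner_curvature_comm u v w]

end Curvature

/-! ### `Ric` and `Ric*` as traces, hence independent of the orthonormal basis. -/

theorem sum_inner_eq_trace {ι : Type*} [Fintype ι] {V : Type*} [NormedAddCommGroup V]
    [InnerProductSpace ℝ V] [FiniteDimensional ℝ V] (e : OrthonormalBasis ι ℝ V) (A : V →ₗ[ℝ] V) :
    ∑ i, (inner ℝ (A (e i)) (e i) : ℝ) = LinearMap.trace ℝ V A := by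
  rw [A.trace_eq_sum_inner e]
  exact Finset.sum_congr rfl fun i _ ↦ real_inner_comm _ _

section Ricci

variable (J : OrthogonalAlmostComplexStructure I M) {x : M} (X Y : TangentSpace I x)

theorem ricci_eq_trace : ricci x X Y = LinearMap.trace ℝ _ (curvatureMap X Y) :=
  sum_inner_eq_trace (stdOrthonormalBasis ℝ (TangentSpace I x)) (curvatureMap X Y)

theorem ricci_eq_sum {ι : Type*} [Fintype ι] (e : OrthonormalBasis ι ℝ (TangentSpace I x)) :
    ricci x X Y = ∑ i, inner ℝ (curvature x X (e i) Y) (e i) := by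
  rw [ricci_eq_trace]
  exact (sum_inner_eq_trace e (curvatureMap X Y)).symm

theorem ricci_comm : ricci x X Y = ricci x Y X :=
  Finset.sum_congr rfl fun _ _ ↦ inner_curvature_pair_comm _ _ _ _

theorem ricciStar_eq_sum {ι : Type*} [Fintype ι] (e : OrthonormalBasis ι ℝ (TangentSpace I x)) :
    ricciStar J x X Y = ∑ i, inner ℝ (curvature x X (e i) (J x Y)) (J x (e i)) := by
  have h : ∀ v : TangentSpace I x, (inner ℝ (curvature x X v (J x Y)) (J x v) : ℝ)
      = inner ℝ ((-(J x : TangentSpace I x →ₗ[ℝ] TangentSpace I x) ∘ₗ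
        curvatureMap X (J x Y)) v) v := by
    intro v
    simp only [LinearMap.comp_apply, LinearMap.neg_apply, ContinuousLinearMap.coe_coe,
      inner_neg_left, inner_J J, neg_neg]
    rfl
  simp only [ricciStar, h]
  rw [sum_inner_eq_trace, sum_inner_eq_trace]

/-- With `S v = R_{JX,v} Y`, the two sides are the traces of `J S` and of `S J`; the second uses the
pair symmetry of the curvature. -/
theorem ricciStar_J : ricciStar J x (J x X) (J x Y) = ricciStar J x Y X := by
  let j : TangentSpace I x →ₗ[ℝ] TangentSpace I x := J x
  have h1 : ricciStar J x (J x X) (J x Y) = LinearMap.trace ℝ _ (j ∘ₗ curvatureMap (J x X) Y) := by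
    rw [← sum_inner_eq_trace (stdOrthonormalBasis ℝ (TangentSpace I x)), ricciStar]
    refine Finset.sum_congr rfl fun i _ ↦ ?_
    rw [J.sq, curvature_neg, inner_neg_left, ← inner_J J]
    rfl
  have h2 : ricciStar J x Y X = LinearMap.trace ℝ _ (curvatureMap (J x X) Y ∘ₗ j) := by
    rw [← sum_inner_eq_trace (stdOrthonormalBasis ℝ (TangentSpace I x)), ricciStar]
    exact Finset.sum_congr rfl fun i _ ↦ inner_curvature_pair_comm _ _ _ _
  rw [h1, h2, LinearMap.trace_comp_comm']

end Ricci

/-! ### The intrinsic torsion and its relation to `∇J`. -/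

section IntrinsicTorsion

variable (J : OrthogonalAlmostComplexStructure I M) {x : M}

theorem contMDiffAt_J {Y : Π x : M, TangentSpace I x} (hY : CMDiffAt 2 (T% Y) x) :
    CMDiffAt 2 (T% (fun y ↦ J y (Y y))) x :=
  ContMDiffAt.clm_bundle_apply (𝕜 := ℝ) (F₁ := E) (F₂ := E) (b := fun y : M ↦ y)
    (E₁ := fun x : M ↦ TangentSpace I x) (E₂ := fun x : M ↦ TangentSpace I x)
    ((J.contMDiff_toFun.of_le (WithTop.coe_le_coe.2 le_top)).contMDiffAt) hY

theorem minimalUnitaryConnection_apply {Y : Π x : M, TangentSpace I x}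
    (hY : MDiffAt (T% Y) x) (v : TangentSpace I x) :
    minimalUnitaryConnection J Y x v
      = leviCivita I M Y x v + intrinsicTorsion J x v (Y x) := by
  rw [intrinsicTorsion, difference_apply _ _ hY]
  abel

/-- The endomorphism `ξ_X`. -/
def intrinsicTorsionMap (X : TangentSpace I x) : TangentSpace I x →ₗ[ℝ] TangentSpace I x where
  toFun Y := intrinsicTorsion J x X Y
  map_add' Y Y' := by simp [intrinsicTorsion]
  map_smul' c Y := by simp [intrinsicTorsion]

theorem intrinsicTorsion_add_left (X X' Y : TangentSpace I x) :
    intrinsicTorsion J x (X + X') Y = intrinsicTorsion J x X Y + intrinsicTorsion J x X' Y := by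
  simp [intrinsicTorsion]

theorem intrinsicTorsion_smul_left (c : ℝ) (X Y : TangentSpace I x) :
    intrinsicTorsion J x (c • X) Y = c • intrinsicTorsion J x X Y := by
  simp [intrinsicTorsion]

theorem intrinsicTorsion_add_right (X Y Y' : TangentSpace I x) :
    intrinsicTorsion J x X (Y + Y') = intrinsicTorsion J x X Y + intrinsicTorsion J x X Y' :=
  (intrinsicTorsionMap J X).map_add Y Y'

theorem intrinsicTorsion_smul_right (c : ℝ) (X Y : TangentSpace I x) :
    intrinsicTorsion J x X (c • Y) = c • intrinsicTorsion J x X Y :=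
  (intrinsicTorsionMap J X).map_smul c Y

theorem inner_intrinsicTorsion (X Y Z : TangentSpace I x) :
    (inner ℝ (intrinsicTorsion J x X Y) Z : ℝ) = - inner ℝ Y (intrinsicTorsion J x X Z) := by
  have hY : MDiffAt (T% (extend E Y)) x := mdifferentiableAt_extend ..
  have hZ : MDiffAt (T% (extend E Z)) x := mdifferentiableAt_extend ..
  have h1 := (isMinimalUnitaryConnection_minimalUnitaryConnection J).metric.mvfderiv_inner_eq
    (extend E X) hY hZ
  have h2 := leviCivita_isMetricCompatible.mvfderiv_inner_eq (extend E X) hY hZ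
  beta_reduce at h1 h2
  rw [h2, minimalUnitaryConnection_apply J hY, minimalUnitaryConnection_apply J hZ] at h1
  simp only [extend_apply_self, inner_add_left, inner_add_right] at h1
  linarith

/-- The endomorphism `A = ξ - JξJ` is twice the `𝔲(n)`-component of `ξ = ξ_X`. Minimality gives `⟨ξ,
A⟩ = 0`, cyclicity of the trace gives `⟨JξJ, A⟩ = 0`, so `‖A‖² = 0`. -/
theorem intrinsicTorsion_J (X Y : TangentSpace I x) :
    intrinsicTorsion J x X (J x Y) = - J x (intrinsicTorsion J x X Y) := by
  let j : TangentSpace I x →ₗ[ℝ] TangentSpace I x := J x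
  let ξ := intrinsicTorsionMap J X
  let A := ξ - j ∘ₗ ξ ∘ₗ j
  let b := stdOrthonormalBasis ℝ (TangentSpace I x)
  have hjj : ∀ v, j (j v) = -v := J.sq x
  have hj : ∀ v w, (inner ℝ (j v) w : ℝ) = - inner ℝ v (j w) := inner_J J x
  have hξ : ∀ v w, (inner ℝ (ξ v) w : ℝ) = - inner ℝ v (ξ w) := inner_intrinsicTorsion J X
  have hskew : ∀ v w, (inner ℝ (A v) w : ℝ) = - inner ℝ v (A w) := by
    intro v w
    simp only [A, LinearMap.sub_apply, LinearMap.comp_apply, inner_sub_left, inner_sub_right, hξ,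
      hj]
    ring
  have hcomm : ∀ v, A (j v) = j (A v) := by
    intro v
    simp only [A, LinearMap.sub_apply, LinearMap.comp_apply, hjj, map_sub, map_neg]
    abel
  have h1 : ∑ i, (inner ℝ (ξ (b i)) (A (b i)) : ℝ) = 0 :=
    (isMinimalUnitaryConnection_minimalUnitaryConnection J).orthogonal x X A hskew hcomm
  have h2 : ∑ i, (inner ℝ (j (ξ (j (b i)))) (A (b i)) : ℝ) = 0 := by
    have e1 : ∀ i, (inner ℝ (j (ξ (j (b i)))) (A (b i)) : ℝ)
        = inner ℝ (((-A) ∘ₗ j ∘ₗ ξ ∘ₗ j) (b i)) (b i) := by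
      intro i
      simp only [LinearMap.comp_apply, LinearMap.neg_apply, inner_neg_left, hskew, neg_neg]
    have e2 : ∀ i, (inner ℝ (ξ (b i)) (A (b i)) : ℝ) = inner ℝ (((-A) ∘ₗ ξ) (b i)) (b i) := by
      intro i
      simp only [LinearMap.comp_apply, LinearMap.neg_apply, inner_neg_left, hskew, neg_neg]
    simp only [e1, sum_inner_eq_trace]
    simp only [e2, sum_inner_eq_trace] at h1
    have e3 : j ∘ₗ (-A) ∘ₗ j = -(-A) := by
      ext v
      simp [← hcomm, hjj]
    rw [← LinearMap.comp_assoc, ← LinearMap.comp_assoc, LinearMap.trace_comp_comm',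
      ← LinearMap.comp_assoc, e3, LinearMap.neg_comp, map_neg, h1, neg_zero]
  have h3 : ∑ i, ‖A (b i)‖ ^ 2 = 0 := by
    have : ∀ i, ‖A (b i)‖ ^ 2
        = inner ℝ (ξ (b i)) (A (b i)) - inner ℝ (j (ξ (j (b i)))) (A (b i)) := by
      intro i
      rw [← inner_sub_left, ← real_inner_self_eq_norm_sq]
      rfl
    simp only [this, Finset.sum_sub_distrib, h1, h2, sub_zero]
  have hA : A = 0 := by
    refine b.toBasis.ext fun i ↦ ?_
    simpa using (Finset.sum_eq_zero_iff_of_nonneg (fun i _ ↦ sq_nonneg ‖A (b i)‖)).1 h3 i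
      (Finset.mem_univ i)
  have h4 : ξ Y = j (ξ (j Y)) := sub_eq_zero.1 congr($hA Y)
  have h5 : j (ξ Y) = - ξ (j Y) := by rw [h4, hjj]
  exact (neg_eq_iff_eq_neg.2 h5).symm

/-- Parallelism of `J` under `∇ + ξ` makes `∇_X J` the commutator `J ξ_X - ξ_X J`, and the two terms
agree because `ξ_X` anticommutes with `J`. -/
theorem covDerivJ_leviCivita (X Y : TangentSpace I x) :
    covDerivJ J (leviCivita I M) x Y X = (2 : ℝ) • J x (intrinsicTorsion J x X Y) := by
  have hY : MDiffAt (T% (extend E Y)) x := mdifferentiableAt_extend ..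
  have h1 := covDerivJ_apply J (leviCivita I M) hY X
  have h2 := (isMinimalUnitaryConnection_minimalUnitaryConnection J).parallel _ x hY X
  rw [minimalUnitaryConnection_apply J hY, minimalUnitaryConnection_apply J (mdiff_J J hY)] at h2
  simp only [extend_apply_self, intrinsicTorsion_J, map_add] at h1 h2
  rw [h1]
  linear_combination (norm := module) h2

theorem leviCivita_J {Y : Π x : M, TangentSpace I x} (hY : MDiffAt (T% Y) x)
    (v : TangentSpace I x) :
    leviCivita I M (fun y ↦ J y (Y y)) x v
      = J x (leviCivita I M Y x v) + (2 : ℝ) • J x (intrinsicTorsion J x v (Y x)) := by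
  rw [← covDerivJ_leviCivita, covDerivJ_apply J _ hY]
  abel

theorem mdifferentiableAt_intrinsicTorsion {X Y : Π x : M, TangentSpace I x}
    (hX : CMDiffAt 2 (T% X) x) (hY : CMDiffAt 2 (T% Y) x) :
    MDiffAt (T% (fun y ↦ intrinsicTorsion J y (X y) (Y y))) x := by
  have h1 := mdiff_J J (mdifferentiableAt_leviCivita hX (contMDiffAt_J J hY))
  have h2 := mdifferentiableAt_leviCivita hX hY
  -- Solving `leviCivita_J` for `ξ` expresses it by `∇` and `J` alone: `ξ_X Y = -½ (J ∇_X(JY) + ∇_X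
  -- Y)`.
  have h3 : MDiffAt (T% (fun y ↦ (-2⁻¹ : ℝ) • (J y (leviCivita I M (fun z ↦ J z (Y z)) y (X y))
      + leviCivita I M Y y (X y)))) x :=
    (mdifferentiableAt_const (c := (-2⁻¹ : ℝ))).smul_section (mdifferentiableAt_add_section h1 h2)
  refine h3.congr_of_eventuallyEq ?_
  filter_upwards [eventually_mdifferentiableAt hY] with y hy
  congr 1
  simp only [leviCivita_J J hy, map_add, map_smul, J.sq]
  module

end IntrinsicTorsion

/-! ### Covariant derivatives of `ξ` and `Jξ`, and the Ricci identity for `J`. -/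

section CovDerivTensor

variable (J : OrthogonalAlmostComplexStructure I M) {x : M}

/-- The covariant derivative `(D_v B)_A C` of a tensor field `B`, computed with the vector
fields `A` and `C`. -/
def covDerivTensorField (D : CovariantDerivative I E (fun x : M ↦ TangentSpace I x))
    (B : Π x : M, TangentSpace I x → TangentSpace I x → TangentSpace I x)
    (v : TangentSpace I x) (A C : Π x : M, TangentSpace I x) : TangentSpace I x :=
  D (fun y ↦ B y (A y) (C y)) x v - B x (D A x v) (C x) - B x (A x) (D C x v)

theorem inner_complexIntrinsicTorsion (y : M) (a b c : TangentSpace I y) :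
    (inner ℝ (complexIntrinsicTorsion J y a b) c : ℝ)
      = - inner ℝ b (complexIntrinsicTorsion J y a c) := by
  rw [complexIntrinsicTorsion, complexIntrinsicTorsion, inner_J, inner_intrinsicTorsion,
    intrinsicTorsion_J, inner_neg_right, neg_neg]

/-- Differentiating the skew-symmetry of `(Jξ)_A` with a metric connection preserves it. As for the
curvature, this serves to show that only the value of `B` at `x` matters. -/
theorem inner_covDerivTensorField {A B C : Π x : M, TangentSpace I x} (hA : CMDiffAt 2 (T% A) x)
    (hB : CMDiffAt 2 (T% B) x) (hC : CMDiffAt 2 (T% C) x) (v : TangentSpace I x) :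
    (inner ℝ (covDerivTensorField (leviCivita I M) (complexIntrinsicTorsion J) v A B) (C x) : ℝ)
      = - inner ℝ (B x)
        (covDerivTensorField (leviCivita I M) (complexIntrinsicTorsion J) v A C) := by
  have mB := hB.mdifferentiableAt (by simp)
  have mC := hC.mdifferentiableAt (by simp)
  have mAB := mdiff_J J (mdifferentiableAt_intrinsicTorsion J hA hB)
  have mAC := mdiff_J J (mdifferentiableAt_intrinsicTorsion J hA hC)
  have hm := leviCivita_isMetricCompatible (I := I) (M := M)
  have h1 := hm.mvfderiv_inner_eq (extend E v) mAB mC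
  have h2 := hm.mvfderiv_inner_eq (extend E v) mB mAC
  have h3 : (fun y ↦ (inner ℝ (J y (intrinsicTorsion J y (A y) (B y))) (C y) : ℝ))
      = fun y ↦ - inner ℝ (B y) (J y (intrinsicTorsion J y (A y) (C y))) := by
    ext y; exact inner_complexIntrinsicTorsion J y _ _ _
  rw [h3, mvfderiv_fun_neg, neg_apply, h2] at h1
  simp only [extend_apply_self] at h1
  have s := inner_complexIntrinsicTorsion J x
  have s1 := s (leviCivita I M A x v) (B x) (C x)
  have s2 := s (A x) (leviCivita I M B x v) (C x)
  have s3 := s (A x) (B x) (leviCivita I M C x v)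
  simp only [covDerivTensorField, inner_sub_left, inner_sub_right]
  simp only [complexIntrinsicTorsion] at *
  linarith

theorem covDerivTensor_eq_field (v a : TangentSpace I x) {B : Π x : M, TangentSpace I x}
    (hB : CMDiffAt 2 (T% B) x) :
    covDerivTensor (leviCivita I M) (complexIntrinsicTorsion J) x v a (B x)
      = covDerivTensorField (leviCivita I M) (complexIntrinsicTorsion J) v (extend E a) B := by
  refine ext_inner_right ℝ fun z ↦ ?_
  have hA : CMDiffAt 2 (T% (extend E a)) x := contMDiffAt_extend ..
  have hB' : CMDiffAt 2 (T% (extend E (B x))) x := contMDiffAt_extend ..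
  have hZ : CMDiffAt 2 (T% (extend E z)) x := contMDiffAt_extend ..
  have h1 := inner_covDerivTensorField J hA hB' hZ v
  have h2 := inner_covDerivTensorField J hA hB hZ v
  have h3 : covDerivTensorField (leviCivita I M) (complexIntrinsicTorsion J) v (extend E a)
      (extend E (B x)) = covDerivTensor (leviCivita I M) (complexIntrinsicTorsion J) x v a (B x) := by
    simp only [covDerivTensorField, covDerivTensor, extend_apply_self]
  rw [extend_apply_self, extend_apply_self, h3] at h1
  rw [extend_apply_self] at h2
  rw [h1, h2]

/-- Extending `J b` by `J B`, where `B` extends `b`, gives `(Jξ)_A (J B) = ξ_A B`, so `J` disappears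
from the differentiated field. The quadratic terms come from `∇(J B) = J ∇B + 2 J ξ B` and from `∇ =
∇̃ - ξ`. -/
theorem covDerivTensor_complexIntrinsicTorsion (v a b : TangentSpace I x) :
    covDerivTensor (leviCivita I M) (complexIntrinsicTorsion J) x v a (J x b)
      = covDerivTensor (minimalUnitaryConnection J) (intrinsicTorsion J) x v a b
        - intrinsicTorsion J x v (intrinsicTorsion J x a b)
        - intrinsicTorsion J x a (intrinsicTorsion J x v b)
        + intrinsicTorsion J x (intrinsicTorsion J x v a) b := by
  have hA : CMDiffAt 2 (T% (extend E a)) x := contMDiffAt_extend ..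
  have hB : CMDiffAt 2 (T% (extend E b)) x := contMDiffAt_extend ..
  have mA := hA.mdifferentiableAt (by simp)
  have mB := hB.mdifferentiableAt (by simp)
  have h := covDerivTensor_eq_field J v a (contMDiffAt_J J hB)
  rw [extend_apply_self] at h
  have h' : (fun y ↦ complexIntrinsicTorsion J y (extend E a y) (J y (extend E b y)))
      = fun y ↦ intrinsicTorsion J y (extend E a y) (extend E b y) := by
    ext y
    simp [complexIntrinsicTorsion, intrinsicTorsion_J, J.sq]
  rw [h, covDerivTensorField, h', leviCivita_J J mB, covDerivTensor,
    minimalUnitaryConnection_apply J mA, minimalUnitaryConnection_apply J mB,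
    minimalUnitaryConnection_apply J (mdifferentiableAt_intrinsicTorsion J hA hB)]
  simp only [complexIntrinsicTorsion, extend_apply_self, intrinsicTorsion_add_left,
    intrinsicTorsion_add_right, intrinsicTorsion_smul_right, intrinsicTorsion_J, map_add, map_smul,
    map_neg, J.sq]
  module

/-- Obtained by differentiating `2 (Jξ)_A B = ∇_A (J B) - J ∇_A B`. The last two terms are together
symmetric in `v`, `a`, so they vanish on antisymmetrising. -/
theorem two_smul_covDerivTensor (v a b : TangentSpace I x) :
    (2 : ℝ) • covDerivTensor (leviCivita I M) (complexIntrinsicTorsion J) x v a b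
      = leviCivita I M (fun y ↦ leviCivita I M (fun z ↦ J z (extend E b z)) y (extend E a y)) x v
        - J x (leviCivita I M (fun y ↦ leviCivita I M (extend E b) y (extend E a y)) x v)
        - leviCivita I M (fun y ↦ J y (extend E b y)) x (leviCivita I M (extend E a) x v)
        + J x (leviCivita I M (extend E b) x (leviCivita I M (extend E a) x v))
        - (2 : ℝ) • J x (intrinsicTorsion J x v (leviCivita I M (extend E b) x a))
        - (2 : ℝ) • J x (intrinsicTorsion J x a (leviCivita I M (extend E b) x v)) := by
  have hA : CMDiffAt 2 (T% (extend E a)) x := contMDiffAt_extend ..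
  have hB : CMDiffAt 2 (T% (extend E b)) x := contMDiffAt_extend ..
  have mB := hB.mdifferentiableAt (by simp)
  have mAB := mdifferentiableAt_leviCivita hA hB
  have mAJB := mdifferentiableAt_leviCivita hA (contMDiffAt_J J hB)
  have mξ : MDiffAt (T% (fun y ↦ complexIntrinsicTorsion J y (extend E a y) (extend E b y))) x :=
    mdiff_J J (mdifferentiableAt_intrinsicTorsion J hA hB)
  have h1 : (2 : ℝ) • leviCivita I M (fun y ↦ complexIntrinsicTorsion J y (extend E a y)
        (extend E b y)) x
      = leviCivita I M (fun y ↦ leviCivita I M (fun z ↦ J z (extend E b z)) y (extend E a y)) x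
        - leviCivita I M (fun y ↦ J y (leviCivita I M (extend E b) y (extend E a y))) x := by
    rw [← (leviCivita I M).isCovariantDerivativeOnUniv.smul_const _ mξ,
      ← leviCivita_sub mAJB (mdiff_J J mAB)]
    refine leviCivita_congr ((mdifferentiableAt_const (c := (2 : ℝ))).smul_section mξ) ?_
    filter_upwards [eventually_mdifferentiableAt hB] with y hy
    rw [leviCivita_J J hy]
    simp [complexIntrinsicTorsion]
  have h2 := congr($h1 v)
  simp only [sub_apply, smul_apply, leviCivita_J J mAB, leviCivita_J J mB, extend_apply_self] at h2 ⊢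
  simp only [covDerivTensor, complexIntrinsicTorsion] at h2 ⊢
  linear_combination (norm := module) h2

theorem two_smul_covDerivTensor_sub_swap (v a b : TangentSpace I x) :
    (2 : ℝ) • (covDerivTensor (leviCivita I M) (complexIntrinsicTorsion J) x v a b
        - covDerivTensor (leviCivita I M) (complexIntrinsicTorsion J) x a v b)
      = curvature x a v (J x b) - J x (curvature x a v b) := by
  have hA : CMDiffAt 2 (T% (extend E a)) x := contMDiffAt_extend ..
  have hV : CMDiffAt 2 (T% (extend E v)) x := contMDiffAt_extend ..
  have hB : CMDiffAt 2 (T% (extend E b)) x := contMDiffAt_extend ..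
  have h : curvature x a v (J x b)
      = curvatureField (extend E a) (extend E v) (fun y ↦ J y (extend E b y)) x := by
    refine ext_inner_right ℝ fun z ↦ ?_
    rw [inner_curvatureField_extend _ _ _ (contMDiffAt_J J hB), extend_apply_self]
  -- Torsion-freeness turns the antisymmetrised terms in `∇_v A` into the bracket term of the
  -- curvature.
  have hbr := leviCivita_sub_swap (hA.mdifferentiableAt (by simp)) (hV.mdifferentiableAt (by simp))
  rw [h, smul_sub, two_smul_covDerivTensor, two_smul_covDerivTensor]
  simp only [curvature, curvatureField, ← hbr, extend_apply_self, map_sub]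
  module

end CovDerivTensor

/-! ### Contraction to the Ricci curvatures. -/

section RicciDifference

variable (J : OrthogonalAlmostComplexStructure I M) {x : M} {ι : Type*} [Fintype ι]
  (e : OrthonormalBasis ι ℝ (TangentSpace I x)) (X Y : TangentSpace I x)

theorem ricciStar_sub_ricci :
    ricciStar J x X Y - ricci x X Y
      = 2 * ∑ i, inner ℝ (covDerivTensor (leviCivita I M) (complexIntrinsicTorsion J) x
          (e i) X (J x Y)) (e i)
        - 2 * ∑ i, inner ℝ (covDerivTensor (leviCivita I M) (complexIntrinsicTorsion J) x
          X (e i) (J x Y)) (e i) := by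
  rw [ricciStar_eq_sum J X Y e, ricci_eq_sum X Y e, ← Finset.sum_sub_distrib, ← mul_sub,
    ← Finset.sum_sub_distrib, Finset.mul_sum]
  refine Finset.sum_congr rfl fun i _ ↦ ?_
  have h := two_smul_covDerivTensor_sub_swap J (e i) X (J x Y)
  rw [J.sq, curvature_neg] at h
  have h' := congr(inner ℝ $h (e i))
  rw [inner_smul_left, inner_sub_left, inner_sub_left, inner_neg_left, inner_J] at h'
  simp only [conj_trivial] at h'
  rw [h']
  ring

theorem ricciStar_sub_ricci_eq_intrinsicTorsion :
    ricciStar J x X Y - ricci x X Y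
      = 2 * ∑ i, inner ℝ (covDerivTensor (minimalUnitaryConnection J) (intrinsicTorsion J) x
          (e i) X Y) (e i)
        - 2 * ∑ i, inner ℝ (covDerivTensor (minimalUnitaryConnection J) (intrinsicTorsion J) x
          X (e i) Y) (e i)
        + 2 * ∑ i, inner ℝ (intrinsicTorsion J x (intrinsicTorsion J x (e i) X) Y) (e i)
        - 2 * ∑ i, inner ℝ (intrinsicTorsion J x (intrinsicTorsion J x X (e i)) Y) (e i) := by
  rw [ricciStar_sub_ricci J e]
  simp only [covDerivTensor_complexIntrinsicTorsion, inner_add_left, inner_sub_left,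
    Finset.sum_add_distrib, Finset.sum_sub_distrib]
  ring

/-- The sum is the trace of the composite of `W ↦ ξ_W Y` with `W ↦ ξ_W X`, and the trace ignores the
order. This is why no `ξ_{ξ_{e_i} X} Y` terms survive in `Ric*_AH`. -/
theorem sum_inner_intrinsicTorsion_comm :
    ∑ i, (inner ℝ (intrinsicTorsion J x (intrinsicTorsion J x (e i) X) Y) (e i) : ℝ)
      = ∑ i, inner ℝ (intrinsicTorsion J x (intrinsicTorsion J x (e i) Y) X) (e i) := by
  let ξ (Z : TangentSpace I x) : TangentSpace I x →ₗ[ℝ] TangentSpace I x :=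
    { toFun W := intrinsicTorsion J x W Z
      map_add' W W' := intrinsicTorsion_add_left J W W' Z
      map_smul' c W := intrinsicTorsion_smul_left J c W Z }
  have h (Z W : TangentSpace I x) :
      ∑ i, (inner ℝ (intrinsicTorsion J x (intrinsicTorsion J x (e i) Z) W) (e i) : ℝ)
        = LinearMap.trace ℝ _ (ξ W ∘ₗ ξ Z) := (sum_inner_eq_trace e _).symm ▸ rfl
  rw [h, h, LinearMap.trace_comp_comm']

end RicciDifference

end AlmostHermitian

end

/-! ### Hermitian and anti-Hermitian parts. -/

theorem lemma3p1 (n : ℕ) (hn : 2 ≤ n)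
    {M : Type*} [TopologicalSpace M] [T2Space M] [SecondCountableTopology M]
    [ChartedSpace (EuclideanSpace ℝ (Fin (2 * n))) M] [IsManifold (𝓡 (2 * n)) ∞ M]
    [RiemannianBundle (fun x : M ↦ TangentSpace (𝓡 (2 * n)) x)]
    [IsContMDiffRiemannianBundle (𝓡 (2 * n)) ∞ (EuclideanSpace ℝ (Fin (2 * n)))
      (fun x : M ↦ TangentSpace (𝓡 (2 * n)) x)]
    (J : AlmostHermitian.OrthogonalAlmostComplexStructure (𝓡 (2 * n)) M)
    (x : M) (e : OrthonormalBasis (Fin (2 * n)) ℝ (TangentSpace (𝓡 (2 * n)) x))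
    (X Y : TangentSpace (𝓡 (2 * n)) x) :
    -- `ξ a b = ξ_a b`, `DJξ v a b = (∇_v (Jξ))_a b`, `Dξ v a b = (∇̃_v ξ)_a b`
    let ξ := AlmostHermitian.intrinsicTorsion J x
    let DJξ := AlmostHermitian.covDerivTensor (AlmostHermitian.leviCivita (𝓡 (2 * n)) M)
      (AlmostHermitian.complexIntrinsicTorsion J) x
    let Dξ := AlmostHermitian.covDerivTensor (AlmostHermitian.minimalUnitaryConnection J)
      (AlmostHermitian.intrinsicTorsion J) x
    let Ric := AlmostHermitian.ricci x
    let RicS := AlmostHermitian.ricciStar J x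
    let H := AlmostHermitian.hermitianPart J (x := x)
    let AH := AlmostHermitian.antiHermitianPart J (x := x)
    -- the difference of the two Ricci curvatures, through `∇` and through `∇̃`
    (RicS X Y - Ric X Y
      = 2 * ∑ i, inner ℝ (DJξ (e i) X (J x Y)) (e i)
        - 2 * ∑ i, inner ℝ (DJξ X (e i) (J x Y)) (e i)) ∧
    (RicS X Y - Ric X Y
      = 2 * ∑ i, inner ℝ (Dξ (e i) X Y) (e i)
        - 2 * ∑ i, inner ℝ (Dξ X (e i) Y) (e i)
        + 2 * ∑ i, inner ℝ (ξ (ξ (e i) X) Y) (e i)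
        - 2 * ∑ i, inner ℝ (ξ (ξ X (e i)) Y) (e i)) ∧
    -- the Hermitian part of the difference
    (H RicS X Y - H Ric X Y
      = ∑ i, inner ℝ (Dξ (e i) X Y) (e i)
        - ∑ i, inner ℝ (Dξ X (e i) Y) (e i)
        + ∑ i, inner ℝ (Dξ (e i) (J x X) (J x Y)) (e i)
        - ∑ i, inner ℝ (Dξ (J x X) (e i) (J x Y)) (e i)
        + ∑ i, inner ℝ (ξ (ξ (e i) X) Y) (e i)
        - ∑ i, inner ℝ (ξ (ξ X (e i)) Y) (e i)
        + ∑ i, inner ℝ (ξ (ξ (e i) (J x X)) (J x Y)) (e i)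
        - ∑ i, inner ℝ (ξ (ξ (J x X) (e i)) (J x Y)) (e i)) ∧
    -- the anti-Hermitian part of the `*`-Ricci curvature
    (2 * AH RicS X Y
      = ∑ i, inner ℝ (Dξ (e i) X Y) (e i)
        - ∑ i, inner ℝ (Dξ (e i) Y X) (e i)
        - ∑ i, inner ℝ (Dξ (e i) (J x X) (J x Y)) (e i)
        + ∑ i, inner ℝ (Dξ (e i) (J x Y) (J x X)) (e i)
        - ∑ i, inner ℝ (Dξ X (e i) Y) (e i)
        + ∑ i, inner ℝ (Dξ Y (e i) X) (e i)
        + ∑ i, inner ℝ (Dξ (J x X) (e i) (J x Y)) (e i)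
        - ∑ i, inner ℝ (Dξ (J x Y) (e i) (J x X)) (e i)
        - ∑ i, inner ℝ (ξ (ξ X (e i)) Y) (e i)
        + ∑ i, inner ℝ (ξ (ξ Y (e i)) X) (e i)
        + ∑ i, inner ℝ (ξ (ξ (J x X) (e i)) (J x Y)) (e i)
        - ∑ i, inner ℝ (ξ (ξ (J x Y) (e i)) (J x X)) (e i)) ∧
    -- the anti-Hermitian part of the Ricci curvature
    (2 * AH Ric X Y
      = - ∑ i, inner ℝ (Dξ (e i) X Y) (e i)
        + ∑ i, inner ℝ (Dξ X (e i) Y) (e i)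
        - ∑ i, inner ℝ (Dξ (e i) Y X) (e i)
        + ∑ i, inner ℝ (Dξ Y (e i) X) (e i)
        + ∑ i, inner ℝ (Dξ (e i) (J x X) (J x Y)) (e i)
        - ∑ i, inner ℝ (Dξ (J x X) (e i) (J x Y)) (e i)
        + ∑ i, inner ℝ (Dξ (e i) (J x Y) (J x X)) (e i)
        - ∑ i, inner ℝ (Dξ (J x Y) (e i) (J x X)) (e i)
        - ∑ i, inner ℝ (ξ (ξ (e i) X) Y) (e i)
        + ∑ i, inner ℝ (ξ (ξ X (e i)) Y) (e i)
        - ∑ i, inner ℝ (ξ (ξ (e i) Y) X) (e i)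
        + ∑ i, inner ℝ (ξ (ξ Y (e i)) X) (e i)
        + ∑ i, inner ℝ (ξ (ξ (e i) (J x X)) (J x Y)) (e i)
        - ∑ i, inner ℝ (ξ (ξ (J x X) (e i)) (J x Y)) (e i)
        + ∑ i, inner ℝ (ξ (ξ (e i) (J x Y)) (J x X)) (e i)
        - ∑ i, inner ℝ (ξ (ξ (J x Y) (e i)) (J x X)) (e i)) := by
  intro ξ DJξ Dξ Ric RicS H AH
  have h1 : ∀ A B, RicS A B - Ric A B = _ :=
    AlmostHermitian.ricciStar_sub_ricci_eq_intrinsicTorsion J e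
  have h2 : ∀ A B, RicS (J x A) (J x B) = RicS B A := AlmostHermitian.ricciStar_J J
  have h3 : ∀ A B, Ric A B = Ric B A := AlmostHermitian.ricci_comm
  have h4 : ∀ A B, ∑ i, (inner ℝ (ξ (ξ (e i) A) B) (e i) : ℝ)
      = ∑ i, inner ℝ (ξ (ξ (e i) B) A) (e i) :=
    AlmostHermitian.sum_inner_intrinsicTorsion_comm J e
  have a1 := h1 X Y
  have a2 := h1 Y X
  have a3 := h1 (J x X) (J x Y)
  have a4 := h1 (J x Y) (J x X)
  have b1 := h2 X Y
  have b2 := h2 Y X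
  have c1 := h3 X Y
  have c2 := h3 (J x X) (J x Y)
  have d1 := h4 X Y
  have d2 := h4 (J x X) (J x Y)
  refine ⟨AlmostHermitian.ricciStar_sub_ricci J e X Y, a1, ?_, ?_, ?_⟩
  · change (RicS X Y + RicS (J x X) (J x Y)) / 2 - (Ric X Y + Ric (J x X) (J x Y)) / 2 = _
    linear_combination (a1 + a3) / 2
  · change 2 * ((RicS X Y - RicS (J x X) (J x Y)) / 2) = _
    -- By `h2`, the form `2 Ric*_AH` is `Ric*(X, Y) - Ric*(Y, X)`. Antisymmetrising in `X`, `Y`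
    -- removes the symmetric `Ric`, and `d1`, `d2` remove the symmetric quadratic terms.
    linear_combination (a1 - a2 - a3 + a4) / 2 - b1 / 2 - b2 / 2 + (c1 - c2) / 2 + d1 - d2
  · change 2 * ((Ric X Y - Ric (J x X) (J x Y)) / 2) = _
    -- Symmetrising in `X`, `Y` instead removes `Ric*`, whose symmetric part is Hermitian by `h2`.
    linear_combination (-a1 - a2 + a3 + a4) / 2 - b1 / 2 - b2 / 2 + (c1 - c2) / 2
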